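/- **Theorem 1 (Network mean-square-error stability).** Let $\mathbb K=\mathbb R$ (real data, $h=1$) or $\mathbb K=\mathbb C$ (complex data, $h=2$); $(\cdot)^*$ is the (conjugate) transpose. A network has $N$ agents; agent $k$ has a neighborhood $\mathcal N_k$ and a parameter $w_k\in\mathbb K^{M_k}$, and $M=\sum_k M_k$. Let $\mathcal U\in\mathbb K^{M\times P}$ be semi-unitary, $\mathcal U^*\mathcal U=I_P$, let $\mathcal P_{\mathcal U}=\mathcal U(\mathcal U^*\mathcal U)^{-1}\mathcal U^*$, and let $\mathcal A\in\mathbb K^{M\times M}$, with blocks $A_{k\ell}\in\mathbb K^{M_k\times M_\ell}$, satisfy $A_{k\ell}=0$ whenever $\ell\notin\mathcal N_k$ and $\ell\ne k$, together with $$\mathcal A\,\mathcal U=\mathcal U,\qquad \mathcal U^*\mathcal A=\mathcal U^*,\qquad \rho(\mathcal A-\mathcal P_{\mathcal U})<1,$$ where $\rho$ is the spectral radius (over the complex eigenvalues). *Costs.* Each $J_k:\mathbb K^{M_k}\to\mathbb R$ is convex and twice differentiable (in the real sense). In the real case $\nabla J_k$ is the gradient and $H_k$ the $M_k\times M_k$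 Hessian matrix. In the complex case $\nabla J_k=\nabla_{w^*}J_k$ is the Wirtinger gradient, with entries $\partial J_k/\partial w_n^*=\frac12(\partial_{x_n}+j\,\partial_{y_n})J_k$ for $w=x+jy$, and $H_k$ is the $2M_k\times 2M_k$ matrix $$H_k=\begin{bmatrix}B&C^*\\ C&B^\top\end{bmatrix},\qquad B_{ab}=\frac{\partial^2J_k}{\partial w_a^*\,\partial w_b},\quad C_{ab}=\frac{\partial^2J_k}{\partial w_a\,\partial w_b}.$$ Assume there are constants $\nu_k\ge0$, $\delta_k$ and $0<\nu\le\delta$ such that for all $k$ and all $w=\mathrm{col}\{w_1,\dots,w_N\}$ $$\tfrac{\nu_k}{h}I\le H_k(w_k)\le\tfrac{\delta_k}{h}I,\qquad \tfrac{\nu}{h}I\le(\mathcal U^e)^*\,\mathrm{diag}\{H_1(w_1),\dots,H_N(w_N)\}\,\mathcal U^e\le\tfrac{\delta}{h}I,$$ where $\mathcal U^e=\mathcal U$ in the real case, and in the complex case $\mathcal U^e$ is the $2M\times 2P$ matrix whose $k$-th block of $2M_k$ rows is $\mathrm{diag}\{\mathcal U_k,\overline{\mathcal U_k}\}$, with $\mathcal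 U_k$ the $k$-th block of $M_k$ rows of $\mathcal U$. *Conclusion.* The problem of minimizing $\sum_kJ_k(w_k)$ over $\mathrm{col}\{w_1,\dots,w_N\}$ in the range of $\mathcal U$ has a unique solution $\mathrm{col}\{w^o_1,\dots,w^o_N\}$. Let moreover $\beta_k,\sigma_{s,k}\in\mathbb R$ be given. Then there are $\mu_0>0$ and $C$ such that the following holds for every step-size $0<\mu\le\mu_0$. Take any probability space, any jointly measurable random approximations $\widehat{\nabla J_k}_{,i}(\cdot)$ of the gradients, and any square-integrable random initial vectors, and let $\boldsymbol w_{k,i}$ be generated by $$\boldsymbol\psi_{k,i}=\boldsymbol w_{k,i-1}-\mu\,\widehat{\nabla J_k}_{,i}(\boldsymbol w_{k,i-1}),\qquad \boldsymbol w_{k,i}=\sum_{\ell\in\mathcal N_k\cup\{k\}}A_{k\ell}\,\boldsymbol\psi_{\ell,i}.$$ Let $\mathcal F_{i-1}$ be the $\sigma$-algebra generated by all $\boldsymbol w_{\ell,j}$ with $j\le i-1$, and suppose that the gradient noise $\boldsymbol s_{k,i}(w)=\nabla J_k(w)-\widehat{\nabla J_k}_{,i}(w)$ satisfies, for every $i$,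 for all square-integrable $\mathcal F_{i-1}$-measurable random vectors $\boldsymbol w_k\in\mathbb K^{M_k}$ ($k=1,\dots,N$) and all $k$, that it is square-integrable at $\boldsymbol w_k$ and $$\mathbb E[\boldsymbol s_{k,i}(\boldsymbol w_k)\mid\mathcal F_{i-1}]=0,\qquad \mathbb E[\|\boldsymbol s_{k,i}(\boldsymbol w_k)\|^2\mid\mathcal F_{i-1}]\le(\beta_k/h)^2\|\boldsymbol w_k\|^2+\sigma_{s,k}^2,$$ $$\mathbb E[\boldsymbol s_{k,i}(\boldsymbol w_k)\boldsymbol s_{\ell,i}(\boldsymbol w_\ell)^*\mid\mathcal F_{i-1}]=0,\qquad \mathbb E[\boldsymbol s_{k,i}(\boldsymbol w_k)\boldsymbol s_{\ell,i}(\boldsymbol w_\ell)^\top\mid\mathcal F_{i-1}]=0\qquad(\ell\ne k).$$ Then $$\limsup_{i\to\infty}\mathbb E\|w^o_k-\boldsymbol w_{k,i}\|^2\le C\mu,\qquad k=1,\dots,N;$$ that is, this limit superior is $O(\mu)$ for small $\mu$. -/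

import Mathlib

open MeasureTheory ProbabilityTheory Filter
open scoped Matrix MatrixOrder ENNReal

universe u

noncomputable section

namespace SubspaceNetwork

/-! Vectors and block matrices over the network -/

/-- Column vectors of length `m` with the Euclidean norm. -/
abbrev Vec (𝕜 : Type) (m : ℕ) : Type := EuclideanSpace 𝕜 (Fin m)

/-- Index set of stacked network vectors `col{w_1, …, w_N}` with `w_k` of length `M k`. -/
abbrev NetIdx {N : ℕ} (M : Fin N → ℕ) : Type := Σ k : Fin N, Fin (M k)

/-- The `(k, ℓ)` block, of size `M k × M ℓ`, of a matrix acting on network vectors. -/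
def block {𝕜 : Type} {N : ℕ} {M : Fin N → ℕ} (A : Matrix (NetIdx M) (NetIdx M) 𝕜)
    (k l : Fin N) : Matrix (Fin (M k)) (Fin (M l)) 𝕜 :=
  Matrix.of fun a b => A ⟨k, a⟩ ⟨l, b⟩

/-- The orthogonal projector `𝒰 (𝒰* 𝒰)⁻¹ 𝒰*` onto the range of a full-column-rank `𝒰`. -/
def projector {𝕜 : Type} [RCLike 𝕜] {ι : Type} [Fintype ι] {P : ℕ}
    (U : Matrix ι (Fin P) 𝕜) : Matrix ι ι 𝕜 :=
  U * (Uᴴ * U)⁻¹ * Uᴴ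

/-- The embedding of the scalars (real or complex) into `ℂ`. -/
def toComplex {𝕜 : Type} [RCLike 𝕜] (z : 𝕜) : ℂ :=
  (RCLike.re z : ℂ) + (RCLike.im z : ℂ) * Complex.I

/-- Spectral radius of a square real or complex matrix: the largest modulus of its *complex*
eigenvalues. -/
def specRadius {𝕜 : Type} [RCLike 𝕜] {ι : Type} [Fintype ι] [DecidableEq ι]
    (A : Matrix ι ι 𝕜) : ℝ≥0∞ :=
  spectralRadius ℂ (A.map toComplex)

/-- The conditions on the combination matrix `𝒜` relative to the neighborhoods `𝒩 k` and to the
matrix `𝒰`. -/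
structure IsCombinationMatrix {𝕜 : Type} [RCLike 𝕜] {N P : ℕ} {M : Fin N → ℕ}
    (𝒩 : Fin N → Finset (Fin N)) (U : Matrix (NetIdx M) (Fin P) 𝕜)
    (A : Matrix (NetIdx M) (NetIdx M) 𝕜) : Prop where
  sparse : ∀ k l : Fin N, l ∉ 𝒩 k → k ≠ l → block A k l = 0
  right_eigen : A * U = U
  left_eigen : Uᴴ * A = Uᴴ
  radius : specRadius (A - projector U) < 1

/-! The constrained problem -/

/-- The network vector `col{w_1, …, w_N}` lies in the range of `𝒰`. -/
def InRange {𝕜 : Type} [RCLike 𝕜] {N P : ℕ} {M : Fin N → ℕ}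
    (U : Matrix (NetIdx M) (Fin P) 𝕜) (w : ∀ k, Vec 𝕜 (M k)) : Prop :=
  ∃ s : Fin P → 𝕜, ∀ k a, w k a = (U *ᵥ s) ⟨k, a⟩

/-- `w` minimizes `∑ₖ J_k(w_k)` over the network vectors in the range of `𝒰`. -/
def IsConstrainedMin {𝕜 : Type} [RCLike 𝕜] {N P : ℕ} {M : Fin N → ℕ}
    (J : ∀ k, Vec 𝕜 (M k) → ℝ) (U : Matrix (NetIdx M) (Fin P) 𝕜)
    (w : ∀ k, Vec 𝕜 (M k)) : Prop :=
  InRange U w ∧ ∀ v : ∀ k, Vec 𝕜 (M k), InRange U v → ∑ k, J k (w k) ≤ ∑ k, J k (v k)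

/-! Differential calculus: real data -/

/-- The Hessian matrix of `J` at `w`, real data. -/
def realHessian {m : ℕ} (J : Vec ℝ m → ℝ) (w : Vec ℝ m) : Matrix (Fin m) (Fin m) ℝ :=
  Matrix.of fun a b =>
    fderiv ℝ (fun v => fderiv ℝ J v (EuclideanSpace.single b 1)) w (EuclideanSpace.single a 1)

/-- Twice (Fréchet) differentiable on the whole space, over `ℝ`. -/
def TwiceDifferentiable {E : Type} [NormedAddCommGroup E] [NormedSpace ℝ E] (J : E → ℝ) : Prop :=
  Differentiable ℝ J ∧ Differentiable ℝ (fderiv ℝ J)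

/-- Conditions on the costs, real data (`h = 1`). -/
structure RealCosts {N P : ℕ} {M : Fin N → ℕ} (U : Matrix (NetIdx M) (Fin P) ℝ)
    (J : ∀ k, Vec ℝ (M k) → ℝ) (νk δk : Fin N → ℝ) (ν δ : ℝ) : Prop where
  twice_diff : ∀ k, TwiceDifferentiable (J k)
  convex : ∀ k, ConvexOn ℝ Set.univ (J k)
  νk_nonneg : ∀ k, 0 ≤ νk k
  hessian_lower : ∀ k w, νk k • (1 : Matrix _ _ ℝ) ≤ realHessian (J k) w
  hessian_upper : ∀ k w, realHessian (J k) w ≤ δk k • (1 : Matrix _ _ ℝ)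
  ν_pos : 0 < ν
  ν_le_δ : ν ≤ δ
  aggregate_lower : ∀ w : ∀ k, Vec ℝ (M k), ν • (1 : Matrix _ _ ℝ) ≤
    Uᴴ * Matrix.blockDiagonal' (fun k => realHessian (J k) (w k)) * U
  aggregate_upper : ∀ w : ∀ k, Vec ℝ (M k),
    Uᴴ * Matrix.blockDiagonal' (fun k => realHessian (J k) (w k)) * U ≤
      δ • (1 : Matrix _ _ ℝ)

/-! Differential calculus: complex data (Wirtinger calculus) -/

/-- The Wirtinger derivative `∂f/∂w_n = (∂f/∂x_n - j ∂f/∂y_n) / 2`, where `w = x + j y`. -/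
def dW {m : ℕ} (n : Fin m) (f : Vec ℂ m → ℂ) (w : Vec ℂ m) : ℂ :=
  (fderiv ℝ f w (EuclideanSpace.single n 1)
    - Complex.I * fderiv ℝ f w (EuclideanSpace.single n Complex.I)) / 2

/-- The conjugate Wirtinger derivative `∂f/∂w_n^* = (∂f/∂x_n + j ∂f/∂y_n) / 2`. -/
def dWbar {m : ℕ} (n : Fin m) (f : Vec ℂ m → ℂ) (w : Vec ℂ m) : ℂ :=
  (fderiv ℝ f w (EuclideanSpace.single n 1)
    + Complex.I * fderiv ℝ f w (EuclideanSpace.single n Complex.I)) / 2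

/-- The complex gradient column vector `∇_{w^*} J`. -/
def wirtingerGradient {m : ℕ} (J : Vec ℂ m → ℝ) (w : Vec ℂ m) : Vec ℂ m :=
  WithLp.toLp 2 fun n => dWbar n (fun v => (J v : ℂ)) w

/-- The matrix `∇_{w^*}[∇_w J]`, with entries `∂²J / ∂w_a^* ∂w_b`. -/
def mixedHessian {m : ℕ} (J : Vec ℂ m → ℝ) (w : Vec ℂ m) : Matrix (Fin m) (Fin m) ℂ :=
  Matrix.of fun a b => dWbar a (fun v => dW b (fun z => (J z : ℂ)) v) w

/-- The matrix `∇_{w^⊤}[∇_w J]`, with entries `∂²J / ∂w_a ∂w_b`. -/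
def pureHessian {m : ℕ} (J : Vec ℂ m → ℝ) (w : Vec ℂ m) : Matrix (Fin m) (Fin m) ℂ :=
  Matrix.of fun a b => dW a (fun v => dW b (fun z => (J z : ℂ)) v) w

/-- The `2m × 2m` complex Hessian matrix of `J` at `w`. -/
def complexHessian {m : ℕ} (J : Vec ℂ m → ℝ) (w : Vec ℂ m) :
    Matrix (Fin m ⊕ Fin m) (Fin m ⊕ Fin m) ℂ :=
  Matrix.fromBlocks (mixedHessian J w) (pureHessian J w)ᴴ
    (pureHessian J w) (mixedHessian J w)ᵀ

/-- The extended matrix `𝒰^e`: the rows of `diag{𝒰, (𝒰^*)^⊤}`, regrouped agent by agent so that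
agent `k` holds its `M k` rows of `[𝒰, 0]` followed by its `M k` rows of `[0, (𝒰^*)^⊤]`. -/
def extendedU {N P : ℕ} {M : Fin N → ℕ} (U : Matrix (NetIdx M) (Fin P) ℂ) :
    Matrix (Σ k : Fin N, Fin (M k) ⊕ Fin (M k)) (Fin P ⊕ Fin P) ℂ :=
  (Matrix.fromBlocks U 0 0 (Uᴴ)ᵀ).submatrix
    (fun i => Sum.map (fun a => (⟨i.1, a⟩ : NetIdx M)) (fun a => (⟨i.1, a⟩ : NetIdx M)) i.2) id

/-- Conditions on the costs, complex data (`h = 2`). -/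
structure ComplexCosts {N P : ℕ} {M : Fin N → ℕ} (U : Matrix (NetIdx M) (Fin P) ℂ)
    (J : ∀ k, Vec ℂ (M k) → ℝ) (νk δk : Fin N → ℝ) (ν δ : ℝ) : Prop where
  twice_diff : ∀ k, TwiceDifferentiable (J k)
  convex : ∀ k, ConvexOn ℝ Set.univ (J k)
  νk_nonneg : ∀ k, 0 ≤ νk k
  hessian_lower : ∀ k w, (νk k / 2) • (1 : Matrix _ _ ℂ) ≤ complexHessian (J k) w
  hessian_upper : ∀ k w, complexHessian (J k) w ≤ (δk k / 2) • (1 : Matrix _ _ ℂ)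
  ν_pos : 0 < ν
  ν_le_δ : ν ≤ δ
  aggregate_lower : ∀ w : ∀ k, Vec ℂ (M k), (ν / 2) • (1 : Matrix _ _ ℂ) ≤
    (extendedU U)ᴴ * Matrix.blockDiagonal' (fun k => complexHessian (J k) (w k)) * extendedU U
  aggregate_upper : ∀ w : ∀ k, Vec ℂ (M k),
    (extendedU U)ᴴ * Matrix.blockDiagonal' (fun k => complexHessian (J k) (w k)) * extendedU U ≤
      (δ / 2) • (1 : Matrix _ _ ℂ)

/-! The distributed strategy and the gradient noise -/

/-- The iterates `w_{k,i}` of the distributed strategy with step-size `μ`, started at `w0`: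
`ψ_{k,i+1} = w_{k,i} - μ ĝ_{k,i+1}(w_{k,i})` and `w_{k,i+1} = ∑_ℓ A_{kℓ} ψ_{ℓ,i+1}`, the sum being
over the neighbors of `k`, with `k` included. Here `ghat k i ω w` is the stochastic approximation
of the gradient of `J_k` at `w` that is available to agent `k` at iteration `i`. -/
def iterates {𝕜 : Type} [RCLike 𝕜] {N : ℕ} {M : Fin N → ℕ} {Ω : Type u} (μ : ℝ)
    (𝒩 : Fin N → Finset (Fin N)) (A : Matrix (NetIdx M) (NetIdx M) 𝕜)
    (ghat : ∀ k, ℕ → Ω → Vec 𝕜 (M k) → Vec 𝕜 (M k)) (w0 : ∀ k, Ω → Vec 𝕜 (M k)) :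
    ℕ → ∀ k, Ω → Vec 𝕜 (M k)
  | 0 => w0
  | i + 1 => fun k ω => ∑ l ∈ insert k (𝒩 k),
      WithLp.toLp 2 (block A k l *ᵥ WithLp.ofLp
        (iterates μ 𝒩 A ghat w0 i l ω
          - (μ : 𝕜) • ghat l (i + 1) ω (iterates μ 𝒩 A ghat w0 i l ω)))

/-- The σ-algebra `ℱ_i` generated by the iterates `w_{ℓ,j}`, for all `ℓ` and all `j ≤ i`. -/
abbrev history {𝕜 : Type} [RCLike 𝕜] {N : ℕ} {M : Fin N → ℕ} {Ω : Type u}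
    (W : ℕ → ∀ k, Ω → Vec 𝕜 (M k)) (i : ℕ) : MeasurableSpace Ω :=
  ⨆ (j : ℕ) (_ : j ≤ i) (l : Fin N), MeasurableSpace.comap (W j l) inferInstance

/-- The gradient noise `s_{k,i}(w) = ∇J_k(w) - ĝ_{k,i}(w)` at a random point `w`. -/
def gradNoise {𝕜 : Type} [RCLike 𝕜] {N : ℕ} {M : Fin N → ℕ} {Ω : Type u}
    (grad : ∀ k, Vec 𝕜 (M k) → Vec 𝕜 (M k)) (ghat : ∀ k, ℕ → Ω → Vec 𝕜 (M k) → Vec 𝕜 (M k))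
    (k : Fin N) (i : ℕ) (w : Ω → Vec 𝕜 (M k)) : Ω → Vec 𝕜 (M k) :=
  fun ω => grad k (w ω) - ghat k i ω (w ω)

/-- Conditions on the gradient noise, relative to the past `ℱ_i` of the iterates `W`. They are
required at all square-integrable points `w_k` that are `ℱ_i`-measurable; the noise there has a
finite second moment, so that the conditional expectations below are genuine. -/
structure GradientNoise {𝕜 : Type} [RCLike 𝕜] {N : ℕ} {M : Fin N → ℕ} {Ω : Type u}
    [MeasurableSpace Ω] (Pr : Measure Ω) (h : ℝ)
    (grad : ∀ k, Vec 𝕜 (M k) → Vec 𝕜 (M k)) (ghat : ∀ k, ℕ → Ω → Vec 𝕜 (M k) → Vec 𝕜 (M k))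
    (W : ℕ → ∀ k, Ω → Vec 𝕜 (M k)) (β σ : Fin N → ℝ) : Prop where
  memLp : ∀ (i : ℕ) (w : ∀ k, Ω → Vec 𝕜 (M k)),
    (∀ k, Measurable[history W i] (w k)) → (∀ k, MemLp (w k) 2 Pr) →
    ∀ k, MemLp (gradNoise grad ghat k (i + 1) (w k)) 2 Pr
  unbiased : ∀ (i : ℕ) (w : ∀ k, Ω → Vec 𝕜 (M k)),
    (∀ k, Measurable[history W i] (w k)) → (∀ k, MemLp (w k) 2 Pr) →
    ∀ k, Pr[gradNoise grad ghat k (i + 1) (w k) | history W i] =ᵐ[Pr] 0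
  uncorrelated : ∀ (i : ℕ) (w : ∀ k, Ω → Vec 𝕜 (M k)),
    (∀ k, Measurable[history W i] (w k)) → (∀ k, MemLp (w k) 2 Pr) →
    ∀ k l, k ≠ l → ∀ (a : Fin (M k)) (b : Fin (M l)),
      Pr[fun ω => gradNoise grad ghat k (i + 1) (w k) ω a
          * star (gradNoise grad ghat l (i + 1) (w l) ω b) | history W i] =ᵐ[Pr] 0
  circular : ∀ (i : ℕ) (w : ∀ k, Ω → Vec 𝕜 (M k)),
    (∀ k, Measurable[history W i] (w k)) → (∀ k, MemLp (w k) 2 Pr) →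
    ∀ k l, k ≠ l → ∀ (a : Fin (M k)) (b : Fin (M l)),
      Pr[fun ω => gradNoise grad ghat k (i + 1) (w k) ω a
          * gradNoise grad ghat l (i + 1) (w l) ω b | history W i] =ᵐ[Pr] 0
  second_moment : ∀ (i : ℕ) (w : ∀ k, Ω → Vec 𝕜 (M k)),
    (∀ k, Measurable[history W i] (w k)) → (∀ k, MemLp (w k) 2 Pr) →
    ∀ k, Pr[fun ω => ‖gradNoise grad ghat k (i + 1) (w k) ω‖ ^ 2 | history W i]
      ≤ᵐ[Pr] fun ω => (β k / h) ^ 2 * ‖w k ω‖ ^ 2 + σ k ^ 2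

end SubspaceNetwork

end

open SubspaceNetwork

noncomputable section

/-! Energies that contract under a power-stable operator -/

section Energy

variable {𝕜 H : Type*} [RCLike 𝕜] [NormedAddCommGroup H] [InnerProductSpace 𝕜 H]

/-! Stack the iterates into one vector `w`, let `Q` be the orthogonal projector onto the range of
`U` and `g` the stacked gradient field. One iteration is `w' = A (w - μ g(w) + μ s)` with noise `s`,
and the minimizer is the unique `p` with `Q p = p` and `Q (g p) = 0`. Since `A Q = Q A = Q`, the
error splits orthogonally into `Q w - p` and `w - Q w`, coupled only weakly.

Inside the range the iteration is a projected gradient descent. The Hessian bound compressed by `U`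
makes `g` strongly monotone in these directions, so the squared error shrinks by a factor `1 - μ c /
2`, up to a leak of order `μ` from the other component. The noise is orthogonal to functions of the
past, so it contributes only at order `μ²`. Off the range, `A - Q` drives the error. It is
power-stable but need not contract the norm; it does contract an equivalent quadratic energy `V` at
a rate independent of `μ`, so the gradient and the noise enter at order `μ²` there as well.

For small `μ` the mean of `‖Q w - p‖² + V (w - Q w)` then satisfies `u (i+1) ≤ (1 - μ c / 4) u i + F
μ²`, whose limit superior is at most `4 F μ / c`. This is the content of
`exists_isContractedEnergy`, `NetworkField.one_step` and `NetworkField.mean_square_stability`; the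
minimizer comes from a Banach fixed point in `NetworkField.exists_stationary`.

Real and complex data meet in `MonotoneCosts`, which keeps only first-order information: the
gradients are Lipschitz and jointly strongly monotone along the range. Mean value arguments derive
it from the Hessian bounds, with `κ = 1` for the gradient and `κ = 2` for the Wirtinger gradient. -/

lemma norm_add_sq_le_young (x y : H) {ε : ℝ} (hε : 0 < ε) :
    ‖x + y‖ ^ 2 ≤ (1 + ε) * ‖x‖ ^ 2 + (1 + ε⁻¹) * ‖y‖ ^ 2 := by
  have h1 : ‖x + y‖ ^ 2 ≤ (‖x‖ + ‖y‖) ^ 2 := by gcongr; exact norm_add_le x y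
  have h2 : 0 ≤ ε⁻¹ * (ε * ‖x‖ - ‖y‖) ^ 2 := by positivity
  have h3 : ε⁻¹ * (ε * ‖x‖ - ‖y‖) ^ 2
      = ε * ‖x‖ ^ 2 - 2 * ‖x‖ * ‖y‖ + ε⁻¹ * ‖y‖ ^ 2 := by
    field_simp
    ring
  nlinarith

/-- A quadratic energy, equivalent to the squared norm, that the operator `B` contracts. -/
structure IsContractedEnergy (B : H →L[𝕜] H) (V : H → ℝ) (γ K : ℝ) : Prop where
  pos : 0 < γ
  le_one : γ ≤ 1
  nonneg : 0 ≤ K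
  continuous : Continuous V
  lower : ∀ y, ‖y‖ ^ 2 ≤ V y
  upper : ∀ y, V y ≤ K * ‖y‖ ^ 2
  contract : ∀ y, V (B y) ≤ (1 - γ) * V y
  young : ∀ x y (ε : ℝ), 0 < ε → V (x + y) ≤ (1 + ε) * V x + (1 + ε⁻¹) * V y

/-- A truncated Lyapunov sum works: with `‖B ^ m‖ < 1/2`, put `V y = ∑ n < m, ‖B ^ n y‖²`. Replacing
`y` by `B y` shifts the sum, exchanging `‖y‖²` for `‖B ^ m y‖²`; the loss is at least `‖y‖² / 2`,
hence at least `V y / (2 K)`. -/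
lemma exists_isContractedEnergy (B : H →L[𝕜] H)
    (hB : Tendsto (fun n : ℕ => ‖B ^ n‖) atTop (nhds 0)) :
    ∃ V γ K, IsContractedEnergy B V γ K := by
  -- The condition `1 ≤ m` keeps the term `n = 0` in the sum, which gives `‖y‖² ≤ V y`.
  obtain ⟨m, hm, hm1⟩ : ∃ m : ℕ, ‖B ^ m‖ < 1 / 2 ∧ 1 ≤ m :=
    ((hB.eventually_lt_const (by norm_num : (0 : ℝ) < 1 / 2)).and (eventually_ge_atTop 1)).exists
  set K : ℝ := 1 + ∑ n ∈ Finset.range m, ‖B ^ n‖ ^ 2 with hK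
  have hK1 : 1 ≤ K := by
    have : 0 ≤ ∑ n ∈ Finset.range m, ‖B ^ n‖ ^ 2 := by positivity
    linarith
  have hup : ∀ y, ∑ n ∈ Finset.range m, ‖(B ^ n) y‖ ^ 2 ≤ K * ‖y‖ ^ 2 := fun y => by
    calc ∑ n ∈ Finset.range m, ‖(B ^ n) y‖ ^ 2
        ≤ ∑ n ∈ Finset.range m, ‖B ^ n‖ ^ 2 * ‖y‖ ^ 2 := by
          refine Finset.sum_le_sum fun n _ => ?_
          rw [← mul_pow]
          gcongr
          exact (B ^ n).le_opNorm y
      _ ≤ K * ‖y‖ ^ 2 := by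
          rw [← Finset.sum_mul]
          gcongr
          linarith
  refine ⟨fun y => ∑ n ∈ Finset.range m, ‖(B ^ n) y‖ ^ 2, 1 / (2 * K), K,
    by positivity, ?_, by positivity, by fun_prop, ?_, hup, ?_, ?_⟩
  · rw [div_le_one (by positivity)]
    linarith
  · intro y
    have := Finset.single_le_sum (f := fun n => ‖(B ^ n) y‖ ^ 2)
      (fun n _ => by positivity) (Finset.mem_range.2 (by lia : 0 < m))
    simpa using this
  · intro y
    have hshift : ∑ n ∈ Finset.range m, ‖(B ^ n) (B y)‖ ^ 2 + ‖y‖ ^ 2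
        = ∑ n ∈ Finset.range m, ‖(B ^ n) y‖ ^ 2 + ‖(B ^ m) y‖ ^ 2 := by
      have h := Finset.sum_range_succ' (fun n => ‖(B ^ n) y‖ ^ 2) m
      rw [Finset.sum_range_succ] at h
      rw [h]
      simp [pow_succ]
    have hlast : ‖(B ^ m) y‖ ^ 2 ≤ 1 / 2 * ‖y‖ ^ 2 := by
      have h1 : ‖(B ^ m) y‖ ≤ 1 / 2 * ‖y‖ :=
        ((B ^ m).le_opNorm y).trans (by gcongr)
      have h2 : ‖(B ^ m) y‖ ^ 2 ≤ (1 / 2 * ‖y‖) ^ 2 := by gcongr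
      nlinarith [sq_nonneg ‖y‖]
    have hy : 1 / (2 * K) * ∑ n ∈ Finset.range m, ‖(B ^ n) y‖ ^ 2 ≤ 1 / 2 * ‖y‖ ^ 2 := by
      calc 1 / (2 * K) * ∑ n ∈ Finset.range m, ‖(B ^ n) y‖ ^ 2
          ≤ 1 / (2 * K) * (K * ‖y‖ ^ 2) := by gcongr; exact hup y
        _ = 1 / 2 * ‖y‖ ^ 2 := by field_simp
    nlinarith
  · intro x y ε hε
    simp only [Finset.mul_sum]
    rw [← Finset.sum_add_distrib]
    refine Finset.sum_le_sum fun n _ => ?_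
    rw [map_add]
    exact norm_add_sq_le_young _ _ hε

end Energy

/-! One step of the recursion -/

section Step

open RCLike

variable {𝕜 H : Type*} [RCLike 𝕜] [NormedAddCommGroup H] [InnerProductSpace 𝕜 H]

/-- A monotone field `g` on a space with an orthogonal projector `Q`, and a combination operator
`A` that fixes the range of `Q` and its orthogonal complement. -/
structure NetworkField (Q A : H →L[𝕜] H) (g : H → H) (c L : ℝ) : Prop where
  idem : ∀ x, Q (Q x) = Q x
  symm : ∀ x y, inner 𝕜 (Q x) y = inner 𝕜 x (Q y)
  right_eigen : ∀ x, A (Q x) = Q x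
  left_eigen : ∀ x, Q (A x) = Q x
  power_stable : Tendsto (fun n : ℕ => ‖(A - Q) ^ n‖) atTop (nhds 0)
  c_pos : 0 < c
  L_nonneg : 0 ≤ L
  lipschitz : ∀ x y, ‖g x - g y‖ ≤ L * ‖x - y‖
  monotone : ∀ x z, c * ‖Q z‖ ^ 2 ≤ re (inner 𝕜 (Q z) (g (x + Q z) - g x))

namespace NetworkField

variable {Q A : H →L[𝕜] H} {g : H → H} {c L : ℝ}

lemma norm_le (h : NetworkField Q A g c L) (x : H) : ‖Q x‖ ≤ ‖x‖ := by
  have h1 : ‖Q x‖ ^ 2 ≤ ‖x‖ * ‖Q x‖ := by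
    rw [← inner_self_eq_norm_sq (𝕜 := 𝕜), h.symm, h.idem]
    exact re_inner_le_norm x (Q x)
  by_contra! hlt
  nlinarith [norm_nonneg x]

lemma norm_sq_split (h : NetworkField Q A g c L) {p : H} (hp : Q p = p) (w : H) :
    ‖w - p‖ ^ 2 = ‖Q w - p‖ ^ 2 + ‖w - Q w‖ ^ 2 := by
  have horth : inner 𝕜 (Q w - p) (w - Q w) = 0 := by
    have : Q w - p = Q (w - p) := by rw [map_sub, hp]
    rw [this, h.symm, map_sub, h.idem, sub_self, inner_zero_right]
  have h2 := norm_add_sq (𝕜 := 𝕜) (Q w - p) (w - Q w)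
  rw [horth] at h2
  simp only [map_zero, mul_zero, add_zero] at h2
  rw [← h2]
  congr 2
  abel

/-- The projected gradient step contracts differences along the range of `Q`. -/
lemma projected_step (h : NetworkField Q A g c L) {μ : ℝ} (hμ : 0 ≤ μ) (x z : H) :
    ‖Q z - (μ : 𝕜) • Q (g (x + Q z) - g x)‖ ^ 2
      ≤ (1 - 2 * μ * c + μ ^ 2 * L ^ 2) * ‖Q z‖ ^ 2 := by
  rw [norm_sub_sq (𝕜 := 𝕜), inner_smul_right, ← h.symm, h.idem, norm_smul, re_ofReal_mul]
  have h1 := h.monotone x z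
  have h2 : ‖Q (g (x + Q z) - g x)‖ ≤ L * ‖Q z‖ := by
    refine (h.norm_le _).trans ((h.lipschitz _ _).trans_eq ?_)
    simp
  have h3 : ‖Q (g (x + Q z) - g x)‖ ^ 2 ≤ (L * ‖Q z‖) ^ 2 := by gcongr
  rw [norm_ofReal, mul_pow, sq_abs]
  nlinarith [mul_le_mul_of_nonneg_left h1 hμ, mul_le_mul_of_nonneg_left h3 (sq_nonneg μ)]

/-- The error of the projected iterate after one noiseless step from `w`. -/
def drift (Q : H →L[𝕜] H) (g : H → H) (p : H) (μ : ℝ) (w : H) : H :=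
  Q w - p - (μ : 𝕜) • Q (g w)

/-- As `Q (g p) = 0`, the gradient term is `Q (g (Q w) - g p)` plus `Q (g w - g (Q w))`. The first
part is a contracting projected step from `p` to `Q w`; the second is bounded by the Lipschitz
constant times the off-range component. -/
lemma drift_sq_le (h : NetworkField Q A g c L) {p : H} (hp : Q p = p) (hg : Q (g p) = 0)
    {μ : ℝ} (hμ : 0 < μ) (hμL : μ * L ^ 2 ≤ c) (w : H) :
    ‖drift Q g p μ w‖ ^ 2 ≤ (1 - μ * c / 2) * ‖Q w - p‖ ^ 2
      + (μ ^ 2 + 2 * μ / c) * L ^ 2 * ‖w - Q w‖ ^ 2 := by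
  have hc := h.c_pos
  have hQ : Q (w - p) = Q w - p := by rw [map_sub, hp]
  have hsplit : drift Q g p μ w = (Q w - p - (μ : 𝕜) • Q (g (p + (Q w - p)) - g p))
      + (-((μ : 𝕜) • Q (g w - g (Q w)))) := by
    simp only [drift, map_sub, hg, smul_sub, smul_zero, add_sub_cancel]
    abel
  have h1 := h.projected_step hμ.le p (w - p)
  rw [hQ] at h1
  have h2 : ‖-((μ : 𝕜) • Q (g w - g (Q w)))‖ ^ 2 ≤ μ ^ 2 * L ^ 2 * ‖w - Q w‖ ^ 2 := by
    rw [norm_neg, norm_smul, norm_ofReal, mul_pow, sq_abs, mul_assoc, ← mul_pow L]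
    gcongr
    exact (h.norm_le _).trans (h.lipschitz _ _)
  -- This Young weight gives up half of the contraction `1 - μ c` left by `μ L² ≤ c`, and makes the
  -- off-range coefficient `(1 + 2 / (μ c)) μ² L²`, of order `μ`.
  have hε : 0 < μ * c / 2 := by positivity
  rw [hsplit]
  refine (norm_add_sq_le_young _ _ hε).trans ?_
  have h3 : (1 + μ * c / 2) * ‖Q w - p - (μ : 𝕜) • Q (g (p + (Q w - p)) - g p)‖ ^ 2
      ≤ (1 - μ * c / 2) * ‖Q w - p‖ ^ 2 := by
    refine (mul_le_mul_of_nonneg_left h1 (by positivity)).trans ?_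
    rw [← mul_assoc]
    gcongr
    nlinarith [mul_le_mul_of_nonneg_left hμL (by positivity : 0 ≤ μ * (1 + μ * c / 2)),
      sq_nonneg (μ * c)]
  have h4 : (1 + (μ * c / 2)⁻¹) * ‖-((μ : 𝕜) • Q (g w - g (Q w)))‖ ^ 2
      ≤ (μ ^ 2 + 2 * μ / c) * L ^ 2 * ‖w - Q w‖ ^ 2 := by
    refine (mul_le_mul_of_nonneg_left h2 (by positivity)).trans_eq ?_
    field_simp
  linarith

lemma norm_field_sq_le (h : NetworkField Q A g c L) (p w : H) :
    ‖g w‖ ^ 2 ≤ 2 * ‖g p‖ ^ 2 + 2 * L ^ 2 * ‖w - p‖ ^ 2 := by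
  have h1 : ‖g w‖ ≤ ‖g p‖ + L * ‖w - p‖ := by
    have := norm_le_norm_add_norm_sub' (g w) (g p)
    linarith [h.lipschitz w p]
  have h2 : ‖g w‖ ^ 2 ≤ (‖g p‖ + L * ‖w - p‖) ^ 2 := by gcongr
  nlinarith [sq_nonneg (‖g p‖ - L * ‖w - p‖)]

/-- Energy inequality for one noisy step `w ↦ A (w - μ g(w) + μ s)`. -/
lemma one_step (h : NetworkField Q A g c L) {p : H} (hp : Q p = p) (hg : Q (g p) = 0)
    {V : H → ℝ} {γ K : ℝ} (hV : IsContractedEnergy (A - Q) V γ K) :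
    ∃ D : ℝ, 0 ≤ D ∧ ∀ μ : ℝ, 0 < μ → μ ≤ 1 → μ * L ^ 2 ≤ c → ∀ w s w' : H,
      w' = A (w - (μ : 𝕜) • g w + (μ : 𝕜) • s) →
      ‖Q w' - p‖ ^ 2 + V (w' - Q w') ≤ (1 - μ * c / 2 + D * μ ^ 2) * ‖Q w - p‖ ^ 2
        + (1 - γ / 2 + D * μ) * V (w - Q w) + D * μ ^ 2 + D * μ ^ 2 * ‖s‖ ^ 2
        + 2 * μ * re (inner 𝕜 (drift Q g p μ w) (Q s)) := by
  have hγ := hV.pos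
  have hK := hV.nonneg
  have hc := h.c_pos
  -- `E` combines the Young factor for weight `γ / 2`, the bound `K` on `V`, and the 2 from `‖s - g
  -- w‖² ≤ 2 ‖s‖² + 2 ‖g w‖²`. `D` is a sum large enough to dominate every coefficient below, none
  -- of which depends on `μ`.
  set E : ℝ := (1 + (γ / 2)⁻¹) * K * 2 with hE
  have hE0 : 0 ≤ E := by positivity
  set D : ℝ := (1 + 2 / c) * L ^ 2 + E * (2 * L ^ 2) + E * (2 * ‖g p‖ ^ 2) + E + 1 with hD
  refine ⟨D, by positivity, fun μ hμ hμ1 hμL w s w' hw' => ?_⟩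
  have hQw' : Q w' - p = drift Q g p μ w + (μ : 𝕜) • Q s := by
    rw [hw', h.left_eigen]
    simp only [drift, map_add, map_sub, map_smul]
    abel
  -- `Q A = Q` turns `A - Q A` into `A - Q`, and `A Q = Q` makes `A - Q` vanish on `Q w`.
  have hyw' : w' - Q w' = (A - Q) (w - Q w) + (A - Q) ((μ : 𝕜) • (s - g w)) := by
    have h1 : Q w' = Q (w - (μ : 𝕜) • g w + (μ : 𝕜) • s) := by rw [hw', h.left_eigen]
    rw [h1, hw', ← map_add]
    simp only [_root_.sub_apply, map_add, map_sub, map_smul, h.right_eigen,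
      h.idem, smul_sub]
    abel
  have hx : ‖Q w' - p‖ ^ 2 ≤ (1 - μ * c / 2) * ‖Q w - p‖ ^ 2
      + (μ ^ 2 + 2 * μ / c) * L ^ 2 * ‖w - Q w‖ ^ 2
      + 2 * μ * re (inner 𝕜 (drift Q g p μ w) (Q s)) + μ ^ 2 * ‖s‖ ^ 2 := by
    rw [hQw', norm_add_sq (𝕜 := 𝕜), inner_smul_right, re_ofReal_mul, norm_smul, norm_ofReal,
      mul_pow, sq_abs]
    have h1 := h.drift_sq_le hp hg hμ hμL w
    have h2 : μ ^ 2 * ‖Q s‖ ^ 2 ≤ μ ^ 2 * ‖s‖ ^ 2 := by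
      gcongr
      exact h.norm_le s
    linarith
  have hVr : V ((A - Q) ((μ : 𝕜) • (s - g w)))
      ≤ K * (μ ^ 2 * (2 * ‖s‖ ^ 2 + 2 * ‖g w‖ ^ 2)) := by
    have hV0 : 0 ≤ V ((μ : 𝕜) • (s - g w)) := (sq_nonneg _).trans (hV.lower _)
    have h1 : V ((A - Q) ((μ : 𝕜) • (s - g w))) ≤ V ((μ : 𝕜) • (s - g w)) := by
      refine (hV.contract _).trans ?_
      nlinarith
    refine (h1.trans (hV.upper _)).trans ?_
    gcongr
    rw [norm_smul, norm_ofReal, mul_pow, sq_abs]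
    gcongr
    have h2 : ‖s - g w‖ ^ 2 ≤ (‖s‖ + ‖g w‖) ^ 2 := by
      gcongr
      exact norm_sub_le _ _
    nlinarith [sq_nonneg (‖s‖ - ‖g w‖)]
  have hy : V (w' - Q w') ≤ (1 - γ / 2) * V (w - Q w)
      + E * (μ ^ 2 * (‖s‖ ^ 2 + ‖g w‖ ^ 2)) := by
    rw [hyw']
    refine (hV.young _ _ (γ / 2) (by positivity)).trans ?_
    have hV0 : 0 ≤ V (w - Q w) := (sq_nonneg _).trans (hV.lower _)
    have h1 : (1 + γ / 2) * V ((A - Q) (w - Q w)) ≤ (1 - γ / 2) * V (w - Q w) := by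
      refine (mul_le_mul_of_nonneg_left (hV.contract _) (by positivity)).trans ?_
      nlinarith [mul_nonneg (sq_nonneg γ) hV0]
    have h2 := mul_le_mul_of_nonneg_left hVr (by positivity : 0 ≤ 1 + (γ / 2)⁻¹)
    refine (add_le_add h1 h2).trans_eq ?_
    rw [hE]
    ring
  have hgw := h.norm_field_sq_le p w
  rw [h.norm_sq_split hp w] at hgw
  have hyV := hV.lower (w - Q w)
  set X := ‖Q w - p‖ ^ 2
  set Y := V (w - Q w)
  set y2 := ‖w - Q w‖ ^ 2
  set S := ‖s‖ ^ 2
  set T := re (inner 𝕜 (drift Q g p μ w) (Q s))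
  have hX0 : 0 ≤ X := by positivity
  have hy20 : 0 ≤ y2 := by positivity
  have hS0 : 0 ≤ S := by positivity
  have hY0 : 0 ≤ Y := hy20.trans hyV
  have hμ2 : μ ^ 2 ≤ μ := by nlinarith
  have e1 : (μ ^ 2 + 2 * μ / c) * L ^ 2 * y2 ≤ (1 + 2 / c) * L ^ 2 * μ * Y := by
    have : μ ^ 2 + 2 * μ / c ≤ (1 + 2 / c) * μ := by
      have : 2 * μ / c = 2 / c * μ := by ring
      rw [this]
      linarith
    calc (μ ^ 2 + 2 * μ / c) * L ^ 2 * y2 ≤ ((1 + 2 / c) * μ) * L ^ 2 * Y := by gcongr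
      _ = _ := by ring
  have e2 : E * (μ ^ 2 * (S + ‖g w‖ ^ 2)) ≤ E * μ ^ 2 * S + E * (2 * ‖g p‖ ^ 2) * μ ^ 2
      + E * (2 * L ^ 2) * μ ^ 2 * X + E * (2 * L ^ 2) * μ * Y := by
    calc E * (μ ^ 2 * (S + ‖g w‖ ^ 2))
        ≤ E * (μ ^ 2 * (S + (2 * ‖g p‖ ^ 2 + 2 * L ^ 2 * (X + y2)))) := by gcongr
      _ = E * μ ^ 2 * S + E * (2 * ‖g p‖ ^ 2) * μ ^ 2 + E * (2 * L ^ 2) * μ ^ 2 * X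
          + E * (2 * L ^ 2) * μ ^ 2 * y2 := by ring
      _ ≤ _ := by gcongr
  have d1 : E * (2 * L ^ 2) ≤ D := by
    have : 0 ≤ (1 + 2 / c) * L ^ 2 + E * (2 * ‖g p‖ ^ 2) + E + 1 := by positivity
    linarith
  have d2 : (1 + 2 / c) * L ^ 2 + E * (2 * L ^ 2) ≤ D := by
    have : 0 ≤ E * (2 * ‖g p‖ ^ 2) + E + 1 := by positivity
    linarith
  have d3 : E * (2 * ‖g p‖ ^ 2) ≤ D := by
    have : 0 ≤ (1 + 2 / c) * L ^ 2 + E * (2 * L ^ 2) + E + 1 := by positivity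
    linarith
  have d4 : E + 1 ≤ D := by
    have : 0 ≤ (1 + 2 / c) * L ^ 2 + E * (2 * L ^ 2) + E * (2 * ‖g p‖ ^ 2) := by positivity
    linarith
  have f1 := mul_le_mul_of_nonneg_right d1 (by positivity : 0 ≤ μ ^ 2 * X)
  have f2 := mul_le_mul_of_nonneg_right d2 (by positivity : 0 ≤ μ * Y)
  have f3 := mul_le_mul_of_nonneg_right d3 (by positivity : 0 ≤ μ ^ 2)
  have f4 := mul_le_mul_of_nonneg_right d4 (by positivity : 0 ≤ μ ^ 2 * S)
  linarith

end NetworkField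

end Step

/-! Mean-square stability in an inner product space -/

lemma le_of_affine_recursion {u : ℕ → ℝ} {q d : ℝ} (hq : 0 < q) (hq1 : q ≤ 1)
    (hu : ∀ i, u (i + 1) ≤ (1 - q) * u i + d) (i : ℕ) :
    u i ≤ (1 - q) ^ i * (u 0 - d / q) + d / q := by
  induction i with
  | zero => simp
  | succ i ih =>
    have h1 := mul_le_mul_of_nonneg_left ih (by linarith : 0 ≤ 1 - q)
    have h2 : (1 - q) * (d / q) + d = d / q := by
      field_simp
      ring
    rw [pow_succ]
    linarith [hu i]

lemma limsup_ofReal_le_of_affine_recursion {v : ℕ → ℝ≥0∞} {u : ℕ → ℝ} {q d : ℝ} (hq : 0 < q)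
    (hq1 : q ≤ 1) (hu : ∀ i, u (i + 1) ≤ (1 - q) * u i + d)
    (hv : ∀ i, v i ≤ ENNReal.ofReal (u i)) :
    limsup v atTop ≤ ENNReal.ofReal (d / q) := by
  have hlim : Tendsto (fun i : ℕ => ENNReal.ofReal ((1 - q) ^ i * (u 0 - d / q) + d / q)) atTop
      (nhds (ENNReal.ofReal (d / q))) := by
    refine ENNReal.tendsto_ofReal ?_
    have h := tendsto_pow_atTop_nhds_zero_of_lt_one (by linarith : 0 ≤ 1 - q)
      (by linarith : 1 - q < 1)
    simpa using (h.mul_const (u 0 - d / q)).add_const (d / q)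
  rw [← hlim.limsup_eq]
  refine limsup_le_limsup (Eventually.of_forall fun i => (hv i).trans ?_)
  exact ENNReal.ofReal_le_ofReal (le_of_affine_recursion hq hq1 hu i)

lemma memLp_comp_of_linear_growth {Ω H F : Type*} [MeasurableSpace Ω] {Pr : Measure Ω}
    [IsFiniteMeasure Pr] [NormedAddCommGroup H] [NormedAddCommGroup F] {W : Ω → H}
    (hW : MemLp W 2 Pr) {f : H → F} (hf : Continuous f) {a b : ℝ}
    (hfb : ∀ x, ‖f x‖ ≤ a + b * ‖x‖) : MemLp (fun ω => f (W ω)) 2 Pr := by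
  refine ((memLp_const a).add (hW.norm.const_mul b)).mono
    (hf.comp_aestronglyMeasurable hW.1) (Eventually.of_forall fun ω => ?_)
  exact (hfb _).trans (le_abs_self _)

lemma MeasureTheory.MemLp.integrable_re_inner {𝕜 Ω H : Type*} [RCLike 𝕜] [MeasurableSpace Ω]
    {Pr : Measure Ω} [NormedAddCommGroup H] [InnerProductSpace 𝕜 H] {X Y : Ω → H}
    (hX : MemLp X 2 Pr) (hY : MemLp Y 2 Pr) :
    Integrable (fun ω => RCLike.re (inner 𝕜 (X ω) (Y ω))) Pr := by
  refine Integrable.mono (hX.norm.integrable_mul hY.norm)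
    (RCLike.continuous_re.comp_aestronglyMeasurable (hX.1.inner hY.1))
    (Eventually.of_forall fun ω => ?_)
  rw [Pi.mul_apply, norm_mul, norm_norm, norm_norm]
  exact (RCLike.norm_re_le_norm _).trans (norm_inner_le_norm _ _)

namespace NetworkField

open RCLike

variable {𝕜 H : Type*} [RCLike 𝕜] [NormedAddCommGroup H] [InnerProductSpace 𝕜 H]
  {Q A : H →L[𝕜] H} {g : H → H} {c L : ℝ}

lemma continuous (h : NetworkField Q A g c L) : Continuous g :=
  (LipschitzWith.of_dist_le' (K := L) fun x y => by
    simpa only [dist_eq_norm] using h.lipschitz x y).continuous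

lemma memLp_field (h : NetworkField Q A g c L) {Ω : Type*} [MeasurableSpace Ω] {Pr : Measure Ω}
    [IsFiniteMeasure Pr] {W : Ω → H} (hW : MemLp W 2 Pr) : MemLp (fun ω => g (W ω)) 2 Pr := by
  refine memLp_comp_of_linear_growth hW h.continuous (a := ‖g 0‖) (b := L) fun x => ?_
  have h1 := norm_le_norm_add_norm_sub' (g x) (g 0)
  have h2 := h.lipschitz x 0
  rw [sub_zero] at h2
  linarith

/-- Steady-state mean-square error of the recursion `W ↦ A (W - μ g(W) + μ S)` driven by noise `S`
that is orthogonal to the functions of `W` and has second moment at most `b E‖W‖² + v`. -/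
theorem mean_square_stability (h : NetworkField Q A g c L) {p : H} (hp : Q p = p)
    (hg : Q (g p) = 0) {b v : ℝ} (hb : 0 ≤ b) (hv : 0 ≤ v) :
    ∃ μ₀ > (0 : ℝ), ∃ C : ℝ, ∀ μ : ℝ, 0 < μ → μ ≤ μ₀ →
      ∀ (Ω : Type u) [MeasurableSpace Ω] (Pr : Measure Ω) [IsProbabilityMeasure Pr]
        (W S : ℕ → Ω → H),
        (∀ i ω, W (i + 1) ω = A (W i ω - (μ : 𝕜) • g (W i ω) + (μ : 𝕜) • S i ω)) →
        MemLp (W 0) 2 Pr →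
        (∀ i, MemLp (W i) 2 Pr → MemLp (S i) 2 Pr) →
        (∀ i, MemLp (W i) 2 Pr → ∀ f : H → H, Continuous f → MemLp (fun ω => f (W i ω)) 2 Pr →
          ∫ ω, re (inner 𝕜 (f (W i ω)) (S i ω)) ∂Pr = 0) →
        (∀ i, MemLp (W i) 2 Pr → ∫ ω, ‖S i ω‖ ^ 2 ∂Pr ≤ b * ∫ ω, ‖W i ω‖ ^ 2 ∂Pr + v) →
        limsup (fun i => ∫⁻ ω, ‖p - W i ω‖ₑ ^ 2 ∂Pr) atTop ≤ ENNReal.ofReal (C * μ) := by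
  obtain ⟨V, γ, K, hV⟩ := exists_isContractedEnergy (A - Q) h.power_stable
  obtain ⟨D, hD, hstep⟩ := h.one_step hp hg hV
  have hc := h.c_pos
  have hγ := hV.pos
  have hL := h.L_nonneg
  have hV0 : ∀ y, 0 ≤ V y := fun y => (sq_nonneg _).trans (hV.lower y)
  -- `F` is `D` enlarged by what remains once `E‖S‖²` is replaced by `b (2 ‖p‖² + 2 (X + Y)) + v`.
  set F : ℝ := D + D * (2 * b) + D * (2 * b * ‖p‖ ^ 2 + v) with hF
  have hF0 : 0 ≤ F := by positivity
  -- The first two bounds are those of `one_step`. The next gives `F μ ≤ c / 4`, so half the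
  -- in-range contraction survives. Then `F μ ≤ γ / 4` and `μ c ≤ γ` let the off-range part also
  -- contract at rate `μ c / 4`, and `μ c ≤ 4` keeps `1 - μ c / 4` nonnegative.
  set μ₀ : ℝ := min (min 1 (c / (L ^ 2 + 1))) (min (min (c / (4 * (F + 1)))
    (γ / (4 * (F + 1)))) (min (γ / c) (4 / c))) with hμ₀
  refine ⟨μ₀, by positivity, F / (c / 4), fun μ hμ hμle Ω _ Pr _ W S hW hW0 hS hcross hvar => ?_⟩
  simp only [hμ₀, le_min_iff] at hμle
  obtain ⟨⟨hm1, hm2⟩, ⟨hm3, hm4⟩, hm5, hm6⟩ := hμle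
  rw [le_div_iff₀ (by positivity)] at hm2 hm3 hm4 hm5 hm6
  have hμL : μ * L ^ 2 ≤ c := by nlinarith
  have hmem : ∀ i, MemLp (W i) 2 Pr := by
    intro i
    induction i with
    | zero => exact hW0
    | succ i ih =>
      have h1 := (ih.sub ((h.memLp_field ih).const_smul (μ : 𝕜))).add ((hS i ih).const_smul (μ : 𝕜))
      have h2 := memLp_comp_of_linear_growth h1 A.continuous (a := 0) (b := ‖A‖)
        (fun x => by rw [zero_add]; exact A.le_opNorm x)
      have h3 : W (i + 1) = fun ω => A (W i ω - (μ : 𝕜) • g (W i ω) + (μ : 𝕜) • S i ω) :=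
        funext (hW i)
      rw [h3]
      exact h2
  have hQm : ∀ i, MemLp (fun ω => Q (W i ω)) 2 Pr := fun i =>
    memLp_comp_of_linear_growth (hmem i) Q.continuous (a := 0) (b := 1)
      (fun x => by rw [zero_add, one_mul]; exact h.norm_le x)
  have hXint : ∀ i, Integrable (fun ω => ‖Q (W i ω) - p‖ ^ 2) Pr := fun i =>
    ((hQm i).sub (memLp_const p)).integrable_norm_pow two_ne_zero
  have hyint : ∀ i, Integrable (fun ω => ‖W i ω - Q (W i ω)‖ ^ 2) Pr := fun i =>
    ((hmem i).sub (hQm i)).integrable_norm_pow two_ne_zero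
  have hYint : ∀ i, Integrable (fun ω => V (W i ω - Q (W i ω))) Pr := fun i => by
    refine Integrable.mono' ((hyint i).const_mul K)
      (hV.continuous.comp_aestronglyMeasurable ((hmem i).sub (hQm i)).1)
      (Eventually.of_forall fun ω => ?_)
    rw [Real.norm_of_nonneg (hV0 _)]
    exact hV.upper _
  have hSint : ∀ i, Integrable (fun ω => ‖S i ω‖ ^ 2) Pr := fun i =>
    (hS i (hmem i)).integrable_norm_pow two_ne_zero
  have hdrift : ∀ i, MemLp (fun ω => Q (drift Q g p μ (W i ω))) 2 Pr := fun i => by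
    have h1 : MemLp (fun ω => drift Q g p μ (W i ω)) 2 Pr :=
      ((hQm i).sub (memLp_const p)).sub
        ((memLp_comp_of_linear_growth (h.memLp_field (hmem i)) Q.continuous (a := 0) (b := 1)
          (fun x => by rw [zero_add, one_mul]; exact h.norm_le x)).const_smul (μ : 𝕜))
    exact memLp_comp_of_linear_growth h1 Q.continuous (a := 0) (b := 1)
      (fun x => by rw [zero_add, one_mul]; exact h.norm_le x)
  have hcont := h.continuous
  have hcrossint : ∀ i, Integrable
      (fun ω => re (inner 𝕜 (drift Q g p μ (W i ω)) (Q (S i ω)))) Pr := fun i => by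
    simp_rw [← h.symm]
    exact (hdrift i).integrable_re_inner (hS i (hmem i))
  -- Symmetry moves `Q` onto the drift, which is a continuous function of `W i`, so the
  -- orthogonality hypothesis applies.
  have hcross0 : ∀ i, ∫ ω, re (inner 𝕜 (drift Q g p μ (W i ω)) (Q (S i ω))) ∂Pr = 0 := fun i => by
    simp_rw [← h.symm]
    refine hcross i (hmem i) (fun w => Q (drift Q g p μ w)) ?_ (hdrift i)
    unfold drift
    fun_prop
  set X : ℕ → ℝ := fun i => ∫ ω, ‖Q (W i ω) - p‖ ^ 2 ∂Pr with hX
  set Y : ℕ → ℝ := fun i => ∫ ω, V (W i ω - Q (W i ω)) ∂Pr with hY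
  have hX0 : ∀ i, 0 ≤ X i := fun i => integral_nonneg fun ω => sq_nonneg _
  have hY0 : ∀ i, 0 ≤ Y i := fun i => integral_nonneg fun ω => hV0 _
  have herr : ∀ w, ‖w - p‖ ^ 2 ≤ ‖Q w - p‖ ^ 2 + V (w - Q w) := fun w => by
    rw [h.norm_sq_split hp]
    linarith [hV.lower (w - Q w)]
  have hWsq : ∀ i, ∫ ω, ‖W i ω‖ ^ 2 ∂Pr ≤ 2 * ‖p‖ ^ 2 + 2 * (X i + Y i) := fun i => by
    have hpt : ∀ w : H, ‖w‖ ^ 2 ≤ 2 * ‖p‖ ^ 2 + 2 * (‖Q w - p‖ ^ 2 + V (w - Q w)) := fun w => by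
      have h1 := norm_le_norm_add_norm_sub' w p
      have h2 : ‖w‖ ^ 2 ≤ (‖p‖ + ‖w - p‖) ^ 2 := by gcongr
      nlinarith [sq_nonneg (‖p‖ - ‖w - p‖), herr w]
    calc ∫ ω, ‖W i ω‖ ^ 2 ∂Pr
        ≤ ∫ ω, (2 * ‖p‖ ^ 2 + 2 * (‖Q (W i ω) - p‖ ^ 2 + V (W i ω - Q (W i ω)))) ∂Pr :=
          integral_mono ((hmem i).integrable_norm_pow two_ne_zero)
            ((integrable_const _).add (((hXint i).add (hYint i)).const_mul 2))
            (fun ω => hpt _)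
      _ = _ := by
          have h1 : ∫ ω, (2 * ‖p‖ ^ 2 + 2 * (‖Q (W i ω) - p‖ ^ 2 + V (W i ω - Q (W i ω)))) ∂Pr
              = ∫ _, 2 * ‖p‖ ^ 2 ∂Pr
                + ∫ ω, 2 * (‖Q (W i ω) - p‖ ^ 2 + V (W i ω - Q (W i ω))) ∂Pr :=
            integral_add (integrable_const _) (((hXint i).add (hYint i)).const_mul 2)
          rw [h1, integral_const, integral_const_mul, integral_add (hXint i) (hYint i)]
          simp [hX, hY]
  have hrec : ∀ i, X (i + 1) + Y (i + 1) ≤ (1 - μ * c / 4) * (X i + Y i) + F * μ ^ 2 := fun i => by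
    have hint : X (i + 1) + Y (i + 1) ≤ (1 - μ * c / 2 + D * μ ^ 2) * X i
        + (1 - γ / 2 + D * μ) * Y i + D * μ ^ 2 + D * μ ^ 2 * ∫ ω, ‖S i ω‖ ^ 2 ∂Pr := by
      have i1 := (hXint i).const_mul (1 - μ * c / 2 + D * μ ^ 2)
      have i2 := (hYint i).const_mul (1 - γ / 2 + D * μ)
      have i3 : Integrable (fun _ : Ω => D * μ ^ 2) Pr := integrable_const _
      have i4 := (hSint i).const_mul (D * μ ^ 2)
      have i5 := (hcrossint i).const_mul (2 * μ)
      have hle := integral_mono ((hXint (i + 1)).add (hYint (i + 1)))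
        ((((i1.add i2).add i3).add i4).add i5)
        (fun ω => hstep μ hμ hm1 hμL (W i ω) (S i ω) (W (i + 1) ω) (hW i ω))
      rw [integral_add' (hXint (i + 1)) (hYint (i + 1)),
        integral_add' (((i1.add i2).add i3).add i4) i5, integral_add' ((i1.add i2).add i3) i4,
        integral_add' (i1.add i2) i3, integral_add' i1 i2] at hle
      simp only [integral_const_mul, hcross0 i, mul_zero, add_zero, integral_const, probReal_univ,
        one_smul] at hle
      exact hle
    have hS2 : ∫ ω, ‖S i ω‖ ^ 2 ∂Pr ≤ b * (2 * ‖p‖ ^ 2 + 2 * (X i + Y i)) + v :=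
      (hvar i (hmem i)).trans (by gcongr; exact hWsq i)
    have hμ2 : μ ^ 2 ≤ μ := by nlinarith
    have hX0i := hX0 i
    have hY0i := hY0 i
    have g1 : D * μ ^ 2 * ∫ ω, ‖S i ω‖ ^ 2 ∂Pr
        ≤ D * μ ^ 2 * (b * (2 * ‖p‖ ^ 2 + 2 * (X i + Y i)) + v) := by gcongr
    have k1 : D + D * (2 * b) ≤ F := by
      have : 0 ≤ D * (2 * b * ‖p‖ ^ 2 + v) := by positivity
      linarith
    have k2 : D + D * (2 * b * ‖p‖ ^ 2 + v) ≤ F := by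
      have : 0 ≤ D * (2 * b) := by positivity
      linarith
    have g2 : D * μ ^ 2 * (2 * b) * Y i ≤ D * μ * (2 * b) * Y i := by gcongr
    have m1 := mul_le_mul_of_nonneg_right k1 (by positivity : 0 ≤ μ ^ 2 * X i)
    have m2 := mul_le_mul_of_nonneg_right k1 (by positivity : 0 ≤ μ * Y i)
    have m3 := mul_le_mul_of_nonneg_right k2 (by positivity : 0 ≤ μ ^ 2)
    have n1 : F * μ ^ 2 * X i ≤ μ * c / 4 * X i := by
      have : F * μ ^ 2 ≤ μ * c / 4 := by nlinarith
      gcongr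
    have n2 : F * μ * Y i ≤ (γ / 2 - μ * c / 4) * Y i := by
      have : F * μ ≤ γ / 2 - μ * c / 4 := by nlinarith
      gcongr
    linarith
  have hq : 0 < μ * c / 4 := by positivity
  -- The fixed point of the affine recursion is the forcing `F μ²` divided by the rate `μ c / 4`:
  -- one power of `μ` is lost.
  have hCμ : F / (c / 4) * μ = F * μ ^ 2 / (μ * c / 4) := by field_simp
  rw [hCμ]
  refine limsup_ofReal_le_of_affine_recursion (u := fun i => X i + Y i) hq (by linarith) hrec fun i => ?_
  have hsq : Integrable (fun ω => ‖p - W i ω‖ ^ 2) Pr :=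
    ((memLp_const p).sub (hmem i)).integrable_norm_pow two_ne_zero
  have hconv : ∫⁻ ω, ‖p - W i ω‖ₑ ^ 2 ∂Pr = ENNReal.ofReal (∫ ω, ‖p - W i ω‖ ^ 2 ∂Pr) := by
    rw [ofReal_integral_eq_lintegral_ofReal hsq (Eventually.of_forall fun ω => sq_nonneg _)]
    refine lintegral_congr fun ω => ?_
    rw [ENNReal.ofReal_pow (norm_nonneg _), ofReal_norm]
  rw [hconv]
  refine ENNReal.ofReal_le_ofReal ?_
  rw [hX, hY, ← integral_add (hXint i) (hYint i)]
  refine integral_mono hsq ((hXint i).add (hYint i)) fun ω => ?_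
  simp only
  rw [norm_sub_rev]
  exact herr _

end NetworkField

/-! Minimization along the range of the projector -/

namespace NetworkField

open RCLike

variable {𝕜 H : Type*} [RCLike 𝕜] [NormedAddCommGroup H] [InnerProductSpace 𝕜 H]
  {Q A : H →L[𝕜] H} {g : H → H} {c L : ℝ}

/-- For small `μ`, `x ↦ Q x - μ Q (g (Q x))` is a contraction by `projected_step`. Its values lie in
the range of `Q`, so its fixed point does too, and the fixed-point equation reduces to `Q (g p) =
0`. -/
lemma exists_stationary [CompleteSpace H] (h : NetworkField Q A g c L) :
    ∃ p, Q p = p ∧ Q (g p) = 0 := by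
  have hc := h.c_pos
  -- The first bound makes the squared contraction factor at most `1 - μ c`; the second keeps this
  -- nonnegative for the square root.
  set μ : ℝ := min (c / (L ^ 2 + 1)) (1 / c) with hμdef
  have hμ : 0 < μ := by positivity
  have hμ1 : μ * (L ^ 2 + 1) ≤ c := by
    rw [← le_div_iff₀ (by positivity)]
    exact min_le_left _ _
  have hμ2 : μ * c ≤ 1 := by
    rw [← le_div_iff₀ hc]
    exact min_le_right _ _
  set f : H → H := fun x => Q x - (μ : 𝕜) • Q (g (Q x)) with hf
  have hcontr : ContractingWith (Real.toNNReal (√(1 - μ * c))) f := by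
    constructor
    · rw [← NNReal.coe_lt_coe, Real.coe_toNNReal _ (Real.sqrt_nonneg _), NNReal.coe_one,
        Real.sqrt_lt' one_pos]
      nlinarith [mul_pos hμ hc]
    · refine LipschitzWith.of_dist_le' fun x y => ?_
      rw [dist_eq_norm, dist_eq_norm]
      refine abs_le_of_sq_le_sq' ?_ (by positivity) |>.2
      rw [mul_pow, Real.sq_sqrt (by linarith)]
      have h1 := h.projected_step hμ.le (Q y) (x - y)
      have h2 : f x - f y = Q (x - y) - (μ : 𝕜) • Q (g (Q y + Q (x - y)) - g (Q y)) := by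
        simp only [hf, map_sub, add_sub_cancel, smul_sub]
        abel
      rw [h2]
      refine h1.trans ?_
      have h3 : ‖Q (x - y)‖ ^ 2 ≤ ‖x - y‖ ^ 2 := by
        gcongr
        exact h.norm_le _
      have h4 : 1 - 2 * μ * c + μ ^ 2 * L ^ 2 ≤ 1 - μ * c := by nlinarith
      exact mul_le_mul h4 h3 (sq_nonneg _) (by linarith)
  set p := ContractingWith.fixedPoint f hcontr with hp
  have hfix : Q p - (μ : 𝕜) • Q (g (Q p)) = p := hcontr.fixedPoint_isFixedPt
  have hQp : Q p = p := by
    have h1 := congrArg Q hfix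
    rw [map_sub, map_smul, h.idem, h.idem] at h1
    rw [← h1, hfix]
  refine ⟨p, hQp, ?_⟩
  rw [hQp, sub_eq_self, smul_eq_zero] at hfix
  exact hfix.resolve_left (by exact_mod_cast hμ.ne')

lemma stationary_unique (h : NetworkField Q A g c L) {p q : H} (hp : Q p = p) (hq : Q q = q)
    (hgp : Q (g p) = 0) (hgq : Q (g q) = 0) : p = q := by
  have hQ : Q (q - p) = q - p := by rw [map_sub, hp, hq]
  have h1 := h.monotone p (q - p)
  rw [h.symm, hQ, add_sub_cancel, map_sub, hgp, hgq, sub_zero, inner_zero_right, map_zero] at h1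
  have h2 : ‖q - p‖ ^ 2 ≤ 0 := nonpos_of_mul_nonpos_right h1 h.c_pos
  have h3 : ‖q - p‖ = 0 := by
    have := sq_nonneg ‖q - p‖
    exact pow_eq_zero_iff two_ne_zero |>.1 (le_antisymm h2 this)
  exact (sub_eq_zero.1 (norm_eq_zero.1 h3)).symm

variable {F : H → ℝ} {κ : ℝ}

lemma stationary_of_min (h : NetworkField Q A g c L) (hκ : 0 < κ)
    (hF : ∀ (x z : H) (t : ℝ),
      HasDerivAt (fun t : ℝ => F (x + (t : 𝕜) • z)) (κ * re (inner 𝕜 (g (x + (t : 𝕜) • z)) z)) t)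
    {p : H} (hp : Q p = p) (hmin : ∀ v, Q v = v → F p ≤ F v) : Q (g p) = 0 := by
  -- The test direction is `Q (g p)` itself: it is feasible, and the derivative along it is `κ ‖Q (g
  -- p)‖²`.
  have h1 : IsLocalMin (fun t : ℝ => F (p + (t : 𝕜) • Q (g p))) 0 := by
    refine Eventually.of_forall fun t => ?_
    simp only [ofReal_zero, zero_smul, add_zero]
    exact hmin _ (by rw [map_add, map_smul, h.idem, hp])
  have h2 := h1.hasDerivAt_eq_zero (hF p (Q (g p)) 0)
  rw [ofReal_zero, zero_smul, add_zero, ← h.idem (g p), ← h.symm, inner_self_eq_norm_sq] at h2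
  simpa [hκ.ne'] using h2

/-- Along the segment from `p` to `v`, monotonicity of `g` and `Q (g p) = 0` make the derivative of
`F` nonnegative. -/
lemma min_of_stationary (h : NetworkField Q A g c L) (hκ : 0 < κ)
    (hF : ∀ (x z : H) (t : ℝ),
      HasDerivAt (fun t : ℝ => F (x + (t : 𝕜) • z)) (κ * re (inner 𝕜 (g (x + (t : 𝕜) • z)) z)) t)
    {p : H} (hp : Q p = p) (hg : Q (g p) = 0) {v : H} (hv : Q v = v) : F p ≤ F v := by
  set z := v - p with hz
  have hQz : Q z = z := by rw [hz, map_sub, hv, hp]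
  have hmono : MonotoneOn (fun t : ℝ => F (p + (t : 𝕜) • z)) (Set.Ici 0) := by
    refine monotoneOn_of_deriv_nonneg (convex_Ici 0)
      (fun t _ => (hF p z t).continuousAt.continuousWithinAt)
      (fun t _ => (hF p z t).differentiableAt.differentiableWithinAt) fun t ht => ?_
    rw [interior_Ici, Set.mem_Ioi] at ht
    rw [(hF p z t).deriv]
    have h1 := h.monotone p ((t : 𝕜) • z)
    have h2 : 0 ≤ c * ‖Q ((t : 𝕜) • z)‖ ^ 2 := mul_nonneg h.c_pos.le (sq_nonneg _)
    have h3 : re (inner 𝕜 (Q ((t : 𝕜) • z)) (g p)) = 0 := by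
      rw [h.symm, hg, inner_zero_right, map_zero]
    rw [inner_sub_right, map_sub, h3, sub_zero, map_smul, hQz, inner_smul_left, conj_ofReal,
      re_ofReal_mul, inner_re_symm] at h1
    rw [map_smul, hQz] at h2
    exact mul_nonneg hκ.le (nonneg_of_mul_nonneg_right (h2.trans h1) ht)
  have h4 := hmono (Set.mem_Ici.2 le_rfl) (Set.mem_Ici.2 zero_le_one) zero_le_one
  simpa [hz] using h4

end NetworkField

/-! Powers of matrices of spectral radius less than one -/

section SpectralRadius

-- By Gelfand's formula `‖a ^ n‖ ^ (1/n)` is eventually below some `r < 1`, so the powers decay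
-- geometrically.
attribute [local instance] Matrix.linftyOpNormedRing Matrix.linftyOpNormedAlgebra in
lemma tendsto_pow_of_spectralRadius_lt_one {ι : Type*} [Fintype ι] [DecidableEq ι]
    (a : Matrix ι ι ℂ) (ha : spectralRadius ℂ a < 1) :
    Tendsto (fun n : ℕ => a ^ n) atTop (nhds 0) := by
  have : CompleteSpace (Matrix ι ι ℂ) := FiniteDimensional.complete ℂ _
  obtain ⟨r, hr, hr1⟩ := ENNReal.lt_iff_exists_nnreal_btwn.1 ha
  have hev := (spectrum.pow_nnnorm_pow_one_div_tendsto_nhds_spectralRadius a).eventually_lt_const hr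
  have hr1' : (r : ℝ) < 1 := by exact_mod_cast hr1
  refine squeeze_zero_norm' (a := fun n : ℕ => (r : ℝ) ^ n) ?_
    (tendsto_pow_atTop_nhds_zero_of_lt_one r.2 hr1')
  filter_upwards [hev, eventually_gt_atTop 0] with n hn hn0
  have hn1 : (‖a ^ n‖₊ : ℝ≥0∞) ≤ (r : ℝ≥0∞) ^ n := by
    have h1 := ENNReal.rpow_le_rpow hn.le (Nat.cast_nonneg n)
    rwa [← ENNReal.rpow_mul, one_div, inv_mul_cancel₀ (by positivity), ENNReal.rpow_one,
      ENNReal.rpow_natCast] at h1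
  exact_mod_cast hn1

variable {𝕜 : Type} [RCLike 𝕜]

/-- `toComplex` as a ring homomorphism. -/
def toComplexHom : 𝕜 →+* ℂ where
  toFun := toComplex
  map_one' := by simp [toComplex]
  map_zero' := by simp [toComplex]
  map_add' x y := by
    simp only [toComplex, map_add, Complex.ofReal_add]
    ring
  map_mul' x y := by
    simp only [toComplex, RCLike.mul_re, RCLike.mul_im, Complex.ofReal_sub, Complex.ofReal_add,
      Complex.ofReal_mul]
    linear_combination -((RCLike.im x : ℂ) * RCLike.im y) * Complex.I_sq

lemma norm_toComplex (z : 𝕜) : ‖toComplex z‖ = ‖z‖ := by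
  have h : ‖toComplex z‖ ^ 2 = ‖z‖ ^ 2 := by
    rw [← Complex.normSq_eq_norm_sq, ← RCLike.normSq_eq_def', RCLike.normSq_apply, toComplex,
      Complex.normSq_add_mul_I]
    ring
  exact (sq_eq_sq₀ (norm_nonneg _) (norm_nonneg _)).1 h

/-- `toComplex` is multiplicative and preserves moduli, so the complex limit transfers entry by
entry, real matrices included. -/
lemma tendsto_pow_of_specRadius_lt_one {ι : Type} [Fintype ι] [DecidableEq ι]
    (B : Matrix ι ι 𝕜) (hB : specRadius B < 1) :
    Tendsto (fun n : ℕ => B ^ n) atTop (nhds 0) := by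
  have h := tendsto_pow_of_spectralRadius_lt_one _ hB
  have hpow : ∀ n, (B ^ n).map toComplex = (B.map toComplex) ^ n := fun n =>
    map_pow (RingHom.mapMatrix (toComplexHom (𝕜 := 𝕜))) B n
  refine tendsto_pi_nhds.2 fun i => tendsto_pi_nhds.2 fun j => ?_
  have hij := tendsto_pi_nhds.1 (tendsto_pi_nhds.1 h i) j
  rw [Matrix.zero_apply, tendsto_zero_iff_norm_tendsto_zero] at hij ⊢
  refine hij.congr fun n => ?_
  rw [← hpow, Matrix.map_apply, norm_toComplex]

lemma tendsto_norm_toEuclideanCLM_pow {ι : Type} [Fintype ι] [DecidableEq ι]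
    (B : Matrix ι ι 𝕜) (hB : specRadius B < 1) :
    Tendsto (fun n : ℕ => ‖Matrix.toEuclideanCLM (n := ι) (𝕜 := 𝕜) B ^ n‖) atTop (nhds 0) := by
  have hcont : Continuous (Matrix.toEuclideanCLM (n := ι) (𝕜 := 𝕜)) :=
    LinearMap.continuous_of_finiteDimensional
      (Matrix.toEuclideanCLM (n := ι) (𝕜 := 𝕜)).toAlgEquiv.toLinearMap
  have h := (hcont.tendsto 0).comp (tendsto_pow_of_specRadius_lt_one B hB)
  rw [map_zero] at h
  rw [← tendsto_zero_iff_norm_tendsto_zero]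
  refine h.congr fun n => ?_
  simp

end SpectralRadius

/-! Stacked network vectors -/

section Stacking

open RCLike

variable {𝕜 : Type} {N P : ℕ} {M : Fin N → ℕ}

/-- The stacked network vector `col{w_1, …, w_N}`. -/
def stack (w : ∀ k, Vec 𝕜 (M k)) : EuclideanSpace 𝕜 (NetIdx M) :=
  WithLp.toLp 2 fun i => w i.1 i.2

/-- The part of a stacked network vector that belongs to agent `k`. -/
def agent (x : EuclideanSpace 𝕜 (NetIdx M)) (k : Fin N) : Vec 𝕜 (M k) :=
  WithLp.toLp 2 fun a => x ⟨k, a⟩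

@[simp] lemma stack_agent (x : EuclideanSpace 𝕜 (NetIdx M)) : stack (agent x) = x := rfl

@[simp] lemma agent_stack (w : ∀ k, Vec 𝕜 (M k)) (k : Fin N) : agent (stack w) k = w k := rfl

variable [RCLike 𝕜]

lemma inner_eq_sum_agent (x y : EuclideanSpace 𝕜 (NetIdx M)) :
    inner 𝕜 x y = ∑ k, inner 𝕜 (agent x k) (agent y k) := by
  simp only [PiLp.inner_apply, Fintype.sum_sigma]
  rfl

lemma norm_sq_eq_sum_agent (x : EuclideanSpace 𝕜 (NetIdx M)) :
    ‖x‖ ^ 2 = ∑ k, ‖agent x k‖ ^ 2 := by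
  simp only [EuclideanSpace.norm_sq_eq, Fintype.sum_sigma]
  rfl

lemma norm_agent_le (x : EuclideanSpace 𝕜 (NetIdx M)) (k : Fin N) : ‖agent x k‖ ≤ ‖x‖ := by
  refine (sq_le_sq₀ (norm_nonneg _) (norm_nonneg _)).1 ?_
  rw [norm_sq_eq_sum_agent x]
  exact Finset.single_le_sum (f := fun k => ‖agent x k‖ ^ 2) (fun _ _ => by positivity)
    (Finset.mem_univ k)

lemma continuous_agent (k : Fin N) :
    Continuous fun x : EuclideanSpace 𝕜 (NetIdx M) => agent x k := by
  unfold agent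
  fun_prop

lemma memLp_stack_iff {Ω : Type*} [MeasurableSpace Ω] {Pr : Measure Ω}
    {w : ∀ k, Ω → Vec 𝕜 (M k)} :
    MemLp (fun ω => stack fun k => w k ω) 2 Pr ↔ ∀ k, MemLp (w k) 2 Pr := by
  simp_rw [memLp_piLp_iff]
  exact ⟨fun h k a => h ⟨k, a⟩, fun h i => h i.1 i.2⟩

lemma toEuclideanCLM_stack_apply (A : Matrix (NetIdx M) (NetIdx M) 𝕜)
    (𝒩 : Fin N → Finset (Fin N)) (hA : ∀ k l : Fin N, l ∉ 𝒩 k → k ≠ l → block A k l = 0)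
    (w : ∀ k, Vec 𝕜 (M k)) :
    Matrix.toEuclideanCLM (n := NetIdx M) (𝕜 := 𝕜) A (stack w)
      = stack fun k => ∑ l ∈ insert k (𝒩 k), WithLp.toLp 2 (block A k l *ᵥ WithLp.ofLp (w l)) := by
  have hsum : ∀ k, ∑ l ∈ insert k (𝒩 k), WithLp.toLp 2 (block A k l *ᵥ WithLp.ofLp (w l))
      = ∑ l, WithLp.toLp 2 (block A k l *ᵥ WithLp.ofLp (w l)) := fun k => by
    refine Finset.sum_subset (Finset.subset_univ _) fun l _ hl => ?_
    rw [Finset.mem_insert, not_or] at hl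
    rw [hA k l hl.2 (Ne.symm hl.1), Matrix.zero_mulVec, WithLp.toLp_zero]
  simp_rw [hsum]
  ext ⟨k, a⟩
  rw [Matrix.ofLp_toEuclideanCLM]
  simp [stack, block, Matrix.mulVec, dotProduct, Fintype.sum_sigma]

lemma toEuclideanCLM_apply_apply {ι : Type} [Fintype ι] [DecidableEq ι] (B C : Matrix ι ι 𝕜)
    (x : EuclideanSpace 𝕜 ι) :
    Matrix.toEuclideanCLM (n := ι) (𝕜 := 𝕜) B (Matrix.toEuclideanCLM (n := ι) (𝕜 := 𝕜) C x)
      = Matrix.toEuclideanCLM (n := ι) (𝕜 := 𝕜) (B * C) x := by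
  rw [map_mul]
  rfl

lemma inner_toEuclideanCLM_left {ι : Type} [Fintype ι] [DecidableEq ι] (B : Matrix ι ι 𝕜)
    (x y : EuclideanSpace 𝕜 ι) :
    inner 𝕜 (Matrix.toEuclideanCLM (n := ι) (𝕜 := 𝕜) Bᴴ x) y
      = inner 𝕜 x (Matrix.toEuclideanCLM (n := ι) (𝕜 := 𝕜) B y) := by
  rw [← Matrix.star_eq_conjTranspose, map_star, ContinuousLinearMap.star_eq_adjoint,
    ContinuousLinearMap.adjoint_inner_left]

variable {U : Matrix (NetIdx M) (Fin P) 𝕜}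

lemma projector_eq {ι : Type} [Fintype ι] {U : Matrix ι (Fin P) 𝕜} (hU : Uᴴ * U = 1) :
    projector U = U * Uᴴ := by
  rw [projector, hU, inv_one, Matrix.mul_one]

/-- This identifies feasible points with fixed points of the projector; the coordinates of a fixed
point are `Uᴴ w`. -/
lemma projector_stack_eq_iff (hU : Uᴴ * U = 1) (w : ∀ k, Vec 𝕜 (M k)) :
    Matrix.toEuclideanCLM (n := NetIdx M) (𝕜 := 𝕜) (projector U) (stack w) = stack w
      ↔ InRange U w := by
  rw [projector_eq hU]
  constructor
  · intro h
    refine ⟨Uᴴ *ᵥ WithLp.ofLp (stack w), fun k a => ?_⟩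
    rw [Matrix.mulVec_mulVec, ← Matrix.ofLp_toEuclideanCLM, h]
    rfl
  · rintro ⟨s, hs⟩
    have hw : stack w = WithLp.toLp 2 (U *ᵥ s) := by
      ext ⟨k, a⟩
      exact hs k a
    rw [hw, Matrix.toEuclideanCLM_toLp, Matrix.mulVec_mulVec, Matrix.mul_assoc, hU,
      Matrix.mul_one]

lemma norm_mulVec_of_semiunitary {ι : Type} [Fintype ι] {U : Matrix ι (Fin P) 𝕜}
    (hU : Uᴴ * U = 1) (s : Fin P → 𝕜) : ∑ i, ‖(U *ᵥ s) i‖ ^ 2 = ∑ j, ‖s j‖ ^ 2 := by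
  have h : star (U *ᵥ s) ⬝ᵥ (U *ᵥ s) = star s ⬝ᵥ s := by
    rw [Matrix.star_mulVec, Matrix.dotProduct_mulVec, Matrix.vecMul_vecMul, hU, Matrix.vecMul_one]
  have hn : ∀ (κ : Type) [Fintype κ] (v : κ → 𝕜),
      star v ⬝ᵥ v = ((∑ i, ‖v i‖ ^ 2 : ℝ) : 𝕜) := fun κ _ v => by
    simp [dotProduct, RCLike.conj_mul]
  rw [hn, hn] at h
  exact_mod_cast h

lemma projector_mul_self {ι : Type} [Fintype ι] {U : Matrix ι (Fin P) 𝕜} (hU : Uᴴ * U = 1) :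
    projector U * projector U = projector U := by
  rw [projector_eq hU, Matrix.mul_assoc, ← Matrix.mul_assoc Uᴴ, hU, Matrix.one_mul]

lemma conjTranspose_projector {ι : Type} [Fintype ι] {U : Matrix ι (Fin P) 𝕜}
    (hU : Uᴴ * U = 1) : (projector U)ᴴ = projector U := by
  rw [projector_eq hU, Matrix.conjTranspose_mul, Matrix.conjTranspose_conjTranspose]

end Stacking

/-! The network with first-order information on its costs -/

/-- Costs `J k` with derivative `κ Re⟨g k, ·⟩`, the fields `g k` being Lipschitz and jointly
strongly monotone along the range of `U`. -/
structure MonotoneCosts {𝕜 : Type} [RCLike 𝕜] {N P : ℕ} {M : Fin N → ℕ}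
    (U : Matrix (NetIdx M) (Fin P) 𝕜) (J : ∀ k, Vec 𝕜 (M k) → ℝ)
    (g : ∀ k, Vec 𝕜 (M k) → Vec 𝕜 (M k)) (κ c L : ℝ) : Prop where
  κ_pos : 0 < κ
  c_pos : 0 < c
  L_nonneg : 0 ≤ L
  hasDerivAt : ∀ k (x z : Vec 𝕜 (M k)) (t : ℝ), HasDerivAt (fun t : ℝ => J k (x + (t : 𝕜) • z))
    (κ * RCLike.re (inner 𝕜 (g k (x + (t : 𝕜) • z)) z)) t
  lipschitz : ∀ k (x y : Vec 𝕜 (M k)), ‖g k x - g k y‖ ≤ L * ‖x - y‖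
  monotone : ∀ x z : ∀ k, Vec 𝕜 (M k), InRange U z →
    c * ∑ k, ‖z k‖ ^ 2 ≤ ∑ k, RCLike.re (inner 𝕜 (z k) (g k (x k + z k) - g k (x k)))

namespace MonotoneCosts

open RCLike

variable {𝕜 : Type} [RCLike 𝕜] {N P : ℕ} {M : Fin N → ℕ} {U : Matrix (NetIdx M) (Fin P) 𝕜}
  {A : Matrix (NetIdx M) (NetIdx M) 𝕜} {𝒩 : Fin N → Finset (Fin N)}
  {J : ∀ k, Vec 𝕜 (M k) → ℝ} {g : ∀ k, Vec 𝕜 (M k) → Vec 𝕜 (M k)} {κ c L : ℝ}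

/-- The stacked gradient field. -/
def stackField (g : ∀ k, Vec 𝕜 (M k) → Vec 𝕜 (M k)) (x : EuclideanSpace 𝕜 (NetIdx M)) :
    EuclideanSpace 𝕜 (NetIdx M) :=
  stack fun k => g k (agent x k)

lemma norm_stackField_sub_le (h : MonotoneCosts U J g κ c L)
    (x y : EuclideanSpace 𝕜 (NetIdx M)) : ‖stackField g x - stackField g y‖ ≤ L * ‖x - y‖ := by
  have hL := h.L_nonneg
  have hk : ∀ k, ‖agent (stackField g x - stackField g y) k‖ ^ 2
      ≤ L ^ 2 * ‖agent (x - y) k‖ ^ 2 := fun k => by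
    rw [← mul_pow]
    exact pow_le_pow_left₀ (norm_nonneg _) (h.lipschitz k (agent x k) (agent y k)) 2
  have hsum : ‖stackField g x - stackField g y‖ ^ 2 ≤ (L * ‖x - y‖) ^ 2 := by
    rw [mul_pow, norm_sq_eq_sum_agent (stackField g x - stackField g y),
      norm_sq_eq_sum_agent (x - y), Finset.mul_sum]
    exact Finset.sum_le_sum fun k _ => hk k
  exact (sq_le_sq₀ (norm_nonneg _) (mul_nonneg hL (norm_nonneg _))).1 hsum

lemma stackField_monotone (h : MonotoneCosts U J g κ c L) (x v : EuclideanSpace 𝕜 (NetIdx M))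
    (hv : InRange U (agent v)) :
    c * ‖v‖ ^ 2 ≤ re (inner 𝕜 v (stackField g (x + v) - stackField g x)) := by
  rw [norm_sq_eq_sum_agent, inner_eq_sum_agent, map_sum]
  exact h.monotone (agent x) (agent v) hv

lemma inRange_agent_projector (hU : Uᴴ * U = 1) (z : EuclideanSpace 𝕜 (NetIdx M)) :
    InRange U (agent (Matrix.toEuclideanCLM (n := NetIdx M) (𝕜 := 𝕜) (projector U) z)) := by
  rw [← projector_stack_eq_iff hU, stack_agent, toEuclideanCLM_apply_apply, projector_mul_self hU]

lemma networkField (h : MonotoneCosts U J g κ c L) (hU : Uᴴ * U = 1)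
    (hA : IsCombinationMatrix 𝒩 U A) :
    NetworkField (Matrix.toEuclideanCLM (n := NetIdx M) (𝕜 := 𝕜) (projector U))
      (Matrix.toEuclideanCLM (n := NetIdx M) (𝕜 := 𝕜) A) (stackField g) c L where
  idem x := by rw [toEuclideanCLM_apply_apply, projector_mul_self hU]
  symm x y := by
    have := inner_toEuclideanCLM_left (projector U) x y
    rwa [conjTranspose_projector hU] at this
  right_eigen x := by
    rw [toEuclideanCLM_apply_apply, projector_eq hU, ← Matrix.mul_assoc, hA.right_eigen]
  left_eigen x := by
    rw [toEuclideanCLM_apply_apply, projector_eq hU, Matrix.mul_assoc, hA.left_eigen]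
  power_stable := by
    rw [← map_sub]
    exact tendsto_norm_toEuclideanCLM_pow _ hA.radius
  c_pos := h.c_pos
  L_nonneg := h.L_nonneg
  lipschitz := h.norm_stackField_sub_le
  monotone x z := h.stackField_monotone x _ (inRange_agent_projector hU z)

lemma hasDerivAt_sum (h : MonotoneCosts U J g κ c L) (x z : EuclideanSpace 𝕜 (NetIdx M)) (t : ℝ) :
    HasDerivAt (fun t : ℝ => ∑ k, J k (agent (x + (t : 𝕜) • z) k))
      (κ * re (inner 𝕜 (stackField g (x + (t : 𝕜) • z)) z)) t := by
  rw [inner_eq_sum_agent, map_sum, Finset.mul_sum]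
  exact HasDerivAt.fun_sum fun k _ => h.hasDerivAt k (agent x k) (agent z k) t

lemma isConstrainedMin_iff (h : MonotoneCosts U J g κ c L) (hU : Uᴴ * U = 1)
    (hA : IsCombinationMatrix 𝒩 U A) (w : ∀ k, Vec 𝕜 (M k)) :
    IsConstrainedMin J U w ↔
      Matrix.toEuclideanCLM (n := NetIdx M) (𝕜 := 𝕜) (projector U) (stack w) = stack w ∧
      Matrix.toEuclideanCLM (n := NetIdx M) (𝕜 := 𝕜) (projector U) (stackField g (stack w)) = 0 := by
  have hn := h.networkField hU hA
  rw [IsConstrainedMin, ← projector_stack_eq_iff hU]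
  refine and_congr_right fun hw => ⟨fun hmin => ?_, fun hg v hv => ?_⟩
  · refine hn.stationary_of_min (F := fun x => ∑ k, J k (agent x k)) h.κ_pos h.hasDerivAt_sum hw fun v hv => ?_
    exact hmin (agent v) ((projector_stack_eq_iff hU _).1 hv)
  · exact hn.min_of_stationary (F := fun x => ∑ k, J k (agent x k)) h.κ_pos h.hasDerivAt_sum hw hg
      ((projector_stack_eq_iff hU v).2 hv)

lemma existsUnique_isConstrainedMin (h : MonotoneCosts U J g κ c L) (hU : Uᴴ * U = 1)
    (hA : IsCombinationMatrix 𝒩 U A) : ∃! w, IsConstrainedMin J U w := by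
  have hn := h.networkField hU hA
  obtain ⟨p, hp, hgp⟩ := hn.exists_stationary
  refine ⟨agent p, (h.isConstrainedMin_iff hU hA _).2 ⟨hp, hgp⟩, fun w hw => ?_⟩
  obtain ⟨hw1, hw2⟩ := (h.isConstrainedMin_iff hU hA w).1 hw
  rw [← hn.stationary_unique hw1 hp hw2 hgp]
  rfl

end MonotoneCosts

/-! Gradient noise -/

section Noise

open RCLike

variable {𝕜 : Type} [RCLike 𝕜]

/-- `X` is measurable for the past, so it can be pulled out of the conditional expectation of the
pairing, which leaves the vanishing conditional mean of `S`. -/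
lemma integral_re_inner_eq_zero_of_condExp {m : ℕ} {Ω : Type*} {m₀ mΩ : MeasurableSpace Ω}
    (hm : m₀ ≤ mΩ) {Pr : Measure Ω} [IsProbabilityMeasure Pr] {X S : Ω → Vec 𝕜 m}
    (hXm : Measurable[m₀] X) (hX : MemLp X 2 Pr) (hS : MemLp S 2 Pr)
    (hcond : Pr[S | m₀] =ᵐ[Pr] 0) : ∫ ω, re (inner 𝕜 (X ω) (S ω)) ∂Pr = 0 := by
  -- Over `ℝ`, the real part of the inner product is a bilinear map, the form required for pulling
  -- `X` out.
  have hre : ∀ x y : Vec 𝕜 m, innerSL ℝ x y = re (inner 𝕜 x y) := fun x y => by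
    simp only [innerSL_apply_apply, PiLp.inner_apply, map_sum]
    rfl
  simp_rw [← hre]
  have hint : Integrable (fun ω => innerSL ℝ (X ω) (S ω)) Pr := by
    simp_rw [hre]
    exact hX.integrable_re_inner hS
  have hpull := condExp_bilin_of_stronglyMeasurable_left (innerSL ℝ (E := Vec 𝕜 m))
    hXm.stronglyMeasurable hint (hS.integrable one_le_two)
  rw [← integral_condExp hm, integral_congr_ae hpull]
  refine (integral_congr_ae (g := fun _ => (0 : ℝ)) ?_).trans (by simp)
  filter_upwards [hcond] with ω hω
  rw [hω]
  simp

variable {N P : ℕ} {M : Fin N → ℕ}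

lemma measurable_history {Ω : Type*} (W : ℕ → ∀ k, Ω → Vec 𝕜 (M k)) (i : ℕ) (k : Fin N) :
    Measurable[history W i] (W i k) := by
  refine Measurable.mono (comap_measurable (W i k)) ?_ le_rfl
  exact le_iSup₂_of_le i le_rfl (le_iSup (fun l => MeasurableSpace.comap (W i l) inferInstance) k)

lemma history_le {Ω : Type*} [mΩ : MeasurableSpace Ω] {W : ℕ → ∀ k, Ω → Vec 𝕜 (M k)}
    (hW : ∀ i k, Measurable (W i k)) (i : ℕ) : history W i ≤ mΩ :=
  iSup₂_le fun j _ => iSup_le fun l => (hW j l).comap_le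

lemma measurable_iterates {Ω : Type u} [MeasurableSpace Ω] {μ : ℝ} {𝒩 : Fin N → Finset (Fin N)}
    {A : Matrix (NetIdx M) (NetIdx M) 𝕜} {ghat : ∀ k, ℕ → Ω → Vec 𝕜 (M k) → Vec 𝕜 (M k)}
    {w0 : ∀ k, Ω → Vec 𝕜 (M k)} (hg : ∀ k i, Measurable (Function.uncurry (ghat k i)))
    (hw0 : ∀ k, Measurable (w0 k)) (i : ℕ) (k : Fin N) :
    Measurable (iterates μ 𝒩 A ghat w0 i k) := by
  induction i generalizing k with
  | zero => exact hw0 k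
  | succ i ih =>
    refine Finset.measurable_fun_sum _ fun l _ => ?_
    have h1 : Measurable fun ω => ghat l (i + 1) ω (iterates μ 𝒩 A ghat w0 i l ω) :=
      (hg l (i + 1)).comp (measurable_id.prodMk (ih l))
    have h2 : Continuous fun v : Vec 𝕜 (M l) =>
        (WithLp.toLp 2 (block A k l *ᵥ WithLp.ofLp v) : Vec 𝕜 (M k)) := by
      fun_prop
    exact h2.measurable.comp ((ih l).sub (h1.const_smul (μ : 𝕜)))

lemma measurable_stack {Ω : Type*} {m : MeasurableSpace Ω} {w : ∀ k, Ω → Vec 𝕜 (M k)}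
    (hw : ∀ k, Measurable (w k)) : Measurable fun ω => stack fun k => w k ω := by
  refine (WithLp.measurable_toLp 2 _).comp (measurable_pi_lambda _ fun i => ?_)
  exact (measurable_pi_apply i.2).comp ((WithLp.measurable_ofLp 2 _).comp (hw i.1))

theorem MonotoneCosts.network_stability {U : Matrix (NetIdx M) (Fin P) 𝕜}
    {A : Matrix (NetIdx M) (NetIdx M) 𝕜} {𝒩 : Fin N → Finset (Fin N)}
    {J : ∀ k, Vec 𝕜 (M k) → ℝ} {g : ∀ k, Vec 𝕜 (M k) → Vec 𝕜 (M k)} {κ c L : ℝ}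
    (h : MonotoneCosts U J g κ c L) (hU : Uᴴ * U = 1) (hA : IsCombinationMatrix 𝒩 U A)
    (η : ℝ) (β σ : Fin N → ℝ) {wo : ∀ k, Vec 𝕜 (M k)} (hwo : IsConstrainedMin J U wo) :
    ∃ μ₀ > (0 : ℝ), ∃ C : ℝ, ∀ μ : ℝ, 0 < μ → μ ≤ μ₀ →
      ∀ (Ω : Type u) [MeasurableSpace Ω] (Pr : Measure Ω) [IsProbabilityMeasure Pr]
        (ghat : ∀ k, ℕ → Ω → Vec 𝕜 (M k) → Vec 𝕜 (M k)) (w0 : ∀ k, Ω → Vec 𝕜 (M k)),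
        (∀ k i, Measurable (Function.uncurry (ghat k i))) →
        (∀ k, Measurable (w0 k)) → (∀ k, MemLp (w0 k) 2 Pr) →
        GradientNoise Pr η g ghat (iterates μ 𝒩 A ghat w0) β σ →
        ∀ k, limsup (fun i => ∫⁻ ω, ‖wo k - iterates μ 𝒩 A ghat w0 i k ω‖ₑ ^ 2 ∂Pr) atTop
          ≤ ENNReal.ofReal (C * μ) := by
  have hn := h.networkField hU hA
  obtain ⟨hwo1, hwo2⟩ := (h.isConstrainedMin_iff hU hA wo).1 hwo
  set b : ℝ := ∑ k, (β k / η) ^ 2 with hb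
  set v : ℝ := ∑ k, σ k ^ 2 with hv
  have hb0 : 0 ≤ b := Finset.sum_nonneg fun _ _ => sq_nonneg _
  obtain ⟨μ₀, hμ₀, C, hC⟩ := hn.mean_square_stability hwo1 hwo2 hb0
    (v := v) (Finset.sum_nonneg fun _ _ => sq_nonneg _)
  refine ⟨μ₀, hμ₀, C, fun μ hμ hμle Ω _ Pr _ ghat w0 hghat hw0 hw0L hnoise k => ?_⟩
  set W := iterates μ 𝒩 A ghat w0 with hWdef
  have hWm : ∀ i k, Measurable (W i k) := measurable_iterates hghat hw0
  set s : ℕ → ∀ k, Ω → Vec 𝕜 (M k) := fun i k => gradNoise g ghat k (i + 1) (W i k) with hs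
  have hrec : ∀ i ω, (stack fun k => W (i + 1) k ω) =
      Matrix.toEuclideanCLM (n := NetIdx M) (𝕜 := 𝕜) A ((stack fun k => W i k ω)
        - (μ : 𝕜) • MonotoneCosts.stackField g (stack fun k => W i k ω)
        + (μ : 𝕜) • stack fun k => s i k ω) := fun i ω => by
    -- True gradient minus noise is the approximate gradient, so this is the stack of the `ψ`.
    have h1 : (stack fun k => W i k ω)
        - (μ : 𝕜) • MonotoneCosts.stackField g (stack fun k => W i k ω)
        + (μ : 𝕜) • (stack fun k => s i k ω)
        = stack fun k => W i k ω - (μ : 𝕜) • ghat k (i + 1) ω (W i k ω) := by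
      ext ⟨k, a⟩
      simp only [stack, MonotoneCosts.stackField, agent, hs, gradNoise, PiLp.add_apply,
        PiLp.sub_apply, PiLp.smul_apply, smul_sub]
      abel
    rw [h1, toEuclideanCLM_stack_apply A 𝒩 hA.sparse]
    rfl
  refine (limsup_le_limsup (Eventually.of_forall fun i => ?_)).trans
    (hC μ hμ hμle Ω Pr (fun i ω => stack fun k => W i k ω) (fun i ω => stack fun k => s i k ω)
      hrec (memLp_stack_iff.2 hw0L) ?_ ?_ ?_)
  · refine lintegral_mono fun ω => ?_
    gcongr
    rw [enorm_le_iff_norm_le]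
    exact norm_agent_le (stack wo - stack fun k => W i k ω) k
  · intro i hi
    exact memLp_stack_iff.2 (hnoise.memLp i (W i) (measurable_history W i) (memLp_stack_iff.1 hi))
  · intro i hi f hf hfL
    have hm := history_le hWm i
    have hWL := memLp_stack_iff.1 hi
    have hsL := hnoise.memLp i (W i) (measurable_history W i) hWL
    have hfk : ∀ k, MemLp (fun ω => agent (f (stack fun k => W i k ω)) k) 2 Pr :=
      (memLp_stack_iff (w := fun k ω => agent (f (stack fun k => W i k ω)) k)).1 hfL
    simp_rw [inner_eq_sum_agent, map_sum, agent_stack]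
    rw [integral_finsetSum _ fun k _ => (hfk k).integrable_re_inner (hsL k)]
    refine Finset.sum_eq_zero fun k _ => ?_
    refine integral_re_inner_eq_zero_of_condExp hm ?_ (hfk k) (hsL k)
      (hnoise.unbiased i (W i) (measurable_history W i) hWL k)
    exact ((continuous_agent k).comp hf).measurable.comp
      (measurable_stack (m := history W i) (measurable_history W i))
  · intro i hi
    have hm := history_le hWm i
    have hWL := memLp_stack_iff.1 hi
    have hsL := hnoise.memLp i (W i) (measurable_history W i) hWL
    simp_rw [norm_sq_eq_sum_agent, agent_stack]
    rw [integral_finsetSum _ fun k _ => (hsL k).integrable_norm_pow two_ne_zero,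
      integral_finsetSum _ fun k _ => (hWL k).integrable_norm_pow two_ne_zero, Finset.mul_sum,
      hv, ← Finset.sum_add_distrib]
    refine Finset.sum_le_sum fun k _ => ?_
    have hWk := (hWL k).integrable_norm_pow two_ne_zero
    have h1 := integral_mono_ae integrable_condExp
      ((hWk.const_mul ((β k / η) ^ 2)).add (integrable_const (σ k ^ 2)))
      (hnoise.second_moment i (W i) (measurable_history W i) hWL k)
    rw [integral_condExp hm, integral_add' (hWk.const_mul _) (integrable_const _),
      integral_const_mul, integral_const, probReal_univ, one_smul] at h1
    refine h1.trans ?_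
    gcongr
    exact Finset.single_le_sum (f := fun k => (β k / η) ^ 2) (fun _ _ => sq_nonneg _)
      (Finset.mem_univ k)

end Noise

/-! Second-order bounds and their first-order consequences -/

section SecondOrder

variable {E : Type} [NormedAddCommGroup E] [NormedSpace ℝ E]

/-- Polarization: the forms at `‖u‖ z ± ‖z‖ u` differ by `4 ‖z‖ ‖u‖ B z u`. The scaling gives both
summands length `‖z‖ ‖u‖`, and discarding the nonnegative form at the difference yields the constant
`δ` exactly. -/
lemma norm_le_of_quadratic_bounds {B : E →L[ℝ] E →L[ℝ] ℝ} (hsymm : ∀ x y, B x y = B y x) {δ : ℝ}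
    (hδ : 0 ≤ δ) (h0 : ∀ z, 0 ≤ B z z) (h1 : ∀ z, B z z ≤ δ * ‖z‖ ^ 2) : ‖B‖ ≤ δ := by
  have key : ∀ z u, B z u ≤ δ * ‖z‖ * ‖u‖ := fun z u => by
    rcases eq_or_ne z 0 with rfl | hz
    · simp
    rcases eq_or_ne u 0 with rfl | hu
    · simp
    have hz' := norm_pos_iff.2 hz
    have hu' := norm_pos_iff.2 hu
    have hsum := h1 (‖u‖ • z + ‖z‖ • u)
    have hdiff := h0 (‖u‖ • z - ‖z‖ • u)
    have hnorm : ‖‖u‖ • z + ‖z‖ • u‖ ≤ 2 * (‖z‖ * ‖u‖) := by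
      refine (norm_add_le _ _).trans_eq ?_
      rw [norm_smul, norm_smul, norm_norm, norm_norm]
      ring
    have hsq : ‖‖u‖ • z + ‖z‖ • u‖ ^ 2 ≤ (2 * (‖z‖ * ‖u‖)) ^ 2 := by gcongr
    have hsq' := mul_le_mul_of_nonneg_left hsq hδ
    simp only [map_add, map_sub, map_smul, _root_.add_apply, _root_.sub_apply,
      _root_.smul_apply, smul_eq_mul, hsymm u z] at hsum hdiff
    have hprod : 0 < 4 * (‖z‖ * ‖u‖) := by positivity
    refine le_of_mul_le_mul_left ?_ hprod
    linarith
  refine B.opNorm_le_bound₂ hδ fun z u => ?_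
  rw [Real.norm_eq_abs, abs_le]
  refine ⟨?_, key z u⟩
  have := key z (-u)
  rw [map_neg, norm_neg] at this
  linarith

/-- The second derivative need not be continuous, so the mean value inequality replaces an integral
along the segment. -/
lemma norm_fderiv_sub_le {J : E → ℝ} (hJ : TwiceDifferentiable J) {δ : ℝ} (hδ : 0 ≤ δ)
    (h0 : ∀ x z, 0 ≤ fderiv ℝ (fderiv ℝ J) x z z)
    (h1 : ∀ x z, fderiv ℝ (fderiv ℝ J) x z z ≤ δ * ‖z‖ ^ 2) (x y : E) :
    ‖fderiv ℝ J x - fderiv ℝ J y‖ ≤ δ * ‖x - y‖ := by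
  refine Convex.norm_image_sub_le_of_norm_fderiv_le (𝕜 := ℝ) (s := Set.univ)
    (fun z _ => hJ.2 z) (fun z _ => ?_) convex_univ (Set.mem_univ y) (Set.mem_univ x)
  exact norm_le_of_quadratic_bounds
    (second_derivative_symmetric (fun v => (hJ.1 v).hasFDerivAt) (hJ.2 z).hasFDerivAt)
    hδ (h0 z) (h1 z)

lemma hasDerivAt_fderiv_line {J : E → ℝ} (hJ : TwiceDifferentiable J) (x z : E) (t : ℝ) :
    HasDerivAt (fun t : ℝ => fderiv ℝ J (x + t • z) z)
      (fderiv ℝ (fderiv ℝ J) (x + t • z) z z) t := by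
  have hline : HasDerivAt (fun t : ℝ => x + t • z) z t := by
    simpa using ((hasDerivAt_id t).smul_const z).const_add x
  have h1 := (hJ.2 (x + t • z)).hasFDerivAt.comp_hasDerivAt t hline
  exact ((ContinuousLinearMap.apply ℝ ℝ z).hasFDerivAt.comp_hasDerivAt t h1)

/-- All agents move along their segments with a common parameter `t`, so the mean value inequality
applies to the sum and only the aggregate curvature matters. -/
lemma sum_fderiv_monotone {N : ℕ} {F : Fin N → Type} [∀ k, NormedAddCommGroup (F k)]
    [∀ k, NormedSpace ℝ (F k)] {J : ∀ k, F k → ℝ} (hJ : ∀ k, TwiceDifferentiable (J k)) {C : ℝ}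
    (x z : ∀ k, F k) (h : ∀ y : ∀ k, F k, C ≤ ∑ k, fderiv ℝ (fderiv ℝ (J k)) (y k) (z k) (z k)) :
    C ≤ ∑ k, (fderiv ℝ (J k) (x k + z k) (z k) - fderiv ℝ (J k) (x k) (z k)) := by
  have hd : ∀ t : ℝ, HasDerivAt (fun t : ℝ => ∑ k, fderiv ℝ (J k) (x k + t • z k) (z k))
      (∑ k, fderiv ℝ (fderiv ℝ (J k)) (x k + t • z k) (z k) (z k)) t := fun t =>
    HasDerivAt.fun_sum fun k _ => hasDerivAt_fderiv_line (hJ k) (x k) (z k) t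
  have h1 := mul_sub_le_image_sub_of_le_deriv (f := fun t : ℝ =>
    ∑ k, fderiv ℝ (J k) (x k + t • z k) (z k)) (fun t => (hd t).differentiableAt)
    (C := C) (fun t => by rw [(hd t).deriv]; exact h _) zero_le_one
  simpa using h1

end SecondOrder

/-! ### Monotone costs from bounds on the second derivatives -/

section Costs

open RCLike

variable {𝕜 : Type} [RCLike 𝕜] {N P : ℕ} {M : Fin N → ℕ} {U : Matrix (NetIdx M) (Fin P) 𝕜}
  {J : ∀ k, Vec 𝕜 (M k) → ℝ} {g : ∀ k, Vec 𝕜 (M k) → Vec 𝕜 (M k)} {κ ν : ℝ} {δ : Fin N → ℝ}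

lemma monotoneCosts_of_hessian (hJ : ∀ k, TwiceDifferentiable (J k)) (hκ : 0 < κ) (hν : 0 < ν)
    (hg : ∀ k x z, fderiv ℝ (J k) x z = κ * re (inner 𝕜 (g k x) z))
    (h0 : ∀ k x z, 0 ≤ fderiv ℝ (fderiv ℝ (J k)) x z z)
    (h1 : ∀ k x z, fderiv ℝ (fderiv ℝ (J k)) x z z ≤ δ k * ‖z‖ ^ 2)
    (hagg : ∀ x z : ∀ k, Vec 𝕜 (M k), InRange U z →
      ν * ∑ k, ‖z k‖ ^ 2 ≤ ∑ k, fderiv ℝ (fderiv ℝ (J k)) (x k) (z k) (z k)) :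
    MonotoneCosts U J g κ (ν / κ) ((∑ k, |δ k|) / κ) where
  κ_pos := hκ
  c_pos := by positivity
  L_nonneg := by positivity
  hasDerivAt k x z t := by
    have hz : ∀ t : ℝ, (t : 𝕜) • z = t • z := fun t => by
      ext a
      simp [real_smul_eq_coe_mul]
    simp_rw [hz]
    rw [← hg]
    have hline : HasDerivAt (fun t : ℝ => x + t • z) z t := by
      simpa using ((hasDerivAt_id t).smul_const z).const_add x
    exact ((hJ k).1 (x + t • z)).hasFDerivAt.comp_hasDerivAt t hline
  lipschitz k x y := by
    set d := g k x - g k y with hd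
    have hδ : |δ k| ≤ ∑ k, |δ k| :=
      Finset.single_le_sum (f := fun k => |δ k|) (fun _ _ => abs_nonneg _) (Finset.mem_univ k)
    have h2 := norm_fderiv_sub_le (hJ k) (abs_nonneg (δ k)) (h0 k)
      (fun x z => (h1 k x z).trans (by gcongr; exact le_abs_self _)) x y
    -- Testing the difference of derivatives on `d` itself recovers `‖d‖²`, so a bound on the
    -- derivatives becomes one on the gradients.
    have h3 : κ * ‖d‖ ^ 2 = (fderiv ℝ (J k) x - fderiv ℝ (J k) y) d := by
      rw [_root_.sub_apply, hg, hg, ← mul_sub, ← map_sub, ← inner_sub_left, ← hd,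
        inner_self_eq_norm_sq]
    have h4 : κ * ‖d‖ ^ 2 ≤ (∑ k, |δ k|) * ‖x - y‖ * ‖d‖ := by
      rw [h3]
      refine (le_abs_self _).trans
        (((fderiv ℝ (J k) x - fderiv ℝ (J k) y).le_opNorm d).trans ?_)
      gcongr
      exact h2.trans (by gcongr)
    rw [div_mul_eq_mul_div, le_div_iff₀ hκ]
    rcases (norm_nonneg d).eq_or_lt with hd0 | hd0
    · rw [← hd0, zero_mul]
      positivity
    · refine le_of_mul_le_mul_right ?_ hd0
      linarith
  monotone x z hz := by
    have h2 := sum_fderiv_monotone hJ x z fun y => hagg y z hz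
    simp_rw [hg, ← mul_sub, ← map_sub, ← inner_sub_left] at h2
    rw [← Finset.mul_sum] at h2
    rw [div_mul_eq_mul_div, div_le_iff₀ hκ, mul_comm _ κ]
    refine h2.trans_eq ?_
    congr 1
    exact Finset.sum_congr rfl fun k _ => inner_re_symm _ _

end Costs

/-! Real data -/

section Real

lemma le_quadratic_of_smul_one_le {𝕜 ι : Type} [RCLike 𝕜] [Fintype ι] [DecidableEq ι]
    {H : Matrix ι ι 𝕜} {a : ℝ} (h : a • (1 : Matrix ι ι 𝕜) ≤ H) (x : ι → 𝕜) :
    a * ∑ i, ‖x i‖ ^ 2 ≤ RCLike.re (star x ⬝ᵥ H *ᵥ x) := by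
  have h1 := (Matrix.le_iff.1 h).re_dotProduct_nonneg x
  have h2 : RCLike.re (star x ⬝ᵥ (a • (1 : Matrix ι ι 𝕜)) *ᵥ x) = a * ∑ i, ‖x i‖ ^ 2 := by
    rw [Matrix.smul_mulVec, Matrix.one_mulVec, dotProduct_smul, RCLike.smul_re]
    congr 1
    simp only [dotProduct, Pi.star_apply, RCLike.star_def, RCLike.conj_mul, map_sum]
    exact Finset.sum_congr rfl fun i _ => by rw [← RCLike.ofReal_pow, RCLike.ofReal_re]
  rw [Matrix.sub_mulVec, dotProduct_sub, map_sub, h2] at h1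
  linarith

lemma quadratic_le_of_le_smul_one {𝕜 ι : Type} [RCLike 𝕜] [Fintype ι] [DecidableEq ι]
    {H : Matrix ι ι 𝕜} {a : ℝ} (h : H ≤ a • (1 : Matrix ι ι 𝕜)) (x : ι → 𝕜) :
    RCLike.re (star x ⬝ᵥ H *ᵥ x) ≤ a * ∑ i, ‖x i‖ ^ 2 := by
  have h1 := le_quadratic_of_smul_one_le (H := -H) (a := -a) (by
    rw [neg_smul]
    exact neg_le_neg h) x
  rw [Matrix.neg_mulVec, dotProduct_neg, map_neg] at h1
  linarith

/-- Quadratic forms of a block-diagonal matrix. -/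
lemma quadratic_blockDiagonal' {𝕜 : Type} [RCLike 𝕜] {N : ℕ} {ι : Fin N → Type}
    [∀ k, Fintype (ι k)] (H : ∀ k, Matrix (ι k) (ι k) 𝕜) (y : (Σ k, ι k) → 𝕜) :
    star y ⬝ᵥ Matrix.blockDiagonal' H *ᵥ y
      = ∑ k, star (fun a => y ⟨k, a⟩) ⬝ᵥ H k *ᵥ (fun a => y ⟨k, a⟩) := by
  simp only [dotProduct, Fintype.sum_sigma]
  refine Finset.sum_congr rfl fun k _ => Finset.sum_congr rfl fun a _ => ?_
  congr 1
  simp only [Matrix.mulVec, dotProduct, Fintype.sum_sigma]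
  rw [Finset.sum_eq_single k]
  · simp [Matrix.blockDiagonal'_apply_eq]
  · intro l _ hl
    refine Finset.sum_eq_zero fun b _ => ?_
    rw [Matrix.blockDiagonal'_apply_ne H _ _ (Ne.symm hl), zero_mul]
  · simp

lemma quadratic_congruence {𝕜 ι κ : Type} [RCLike 𝕜] [Fintype ι] [Fintype κ]
    (V : Matrix ι κ 𝕜) (H : Matrix ι ι 𝕜) (x : κ → 𝕜) :
    star x ⬝ᵥ (Vᴴ * H * V) *ᵥ x = star (V *ᵥ x) ⬝ᵥ H *ᵥ (V *ᵥ x) := by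
  rw [← Matrix.mulVec_mulVec, ← Matrix.mulVec_mulVec, Matrix.star_mulVec, Matrix.dotProduct_mulVec]

lemma realHessian_quadratic {m : ℕ} {J : Vec ℝ m → ℝ} (hJ : TwiceDifferentiable J)
    (w z : Vec ℝ m) :
    star (WithLp.ofLp z) ⬝ᵥ realHessian J w *ᵥ WithLp.ofLp z = fderiv ℝ (fderiv ℝ J) w z z := by
  have hentry : ∀ a b, realHessian J w a b = fderiv ℝ (fderiv ℝ J) w
      (EuclideanSpace.single a 1) (EuclideanSpace.single b 1) := fun a b => by
    have h := ((ContinuousLinearMap.apply ℝ ℝ (EuclideanSpace.single b (1 : ℝ))).hasFDerivAt.comp w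
      (hJ.2 w).hasFDerivAt).fderiv
    exact DFunLike.congr_fun h (EuclideanSpace.single a 1)
  have hz : z = ∑ a, z a • EuclideanSpace.single a (1 : ℝ) := by
    ext i
    simp [Finset.sum_apply, Pi.single_apply]
  conv_rhs => rw [hz]
  simp only [dotProduct, Matrix.mulVec, hentry, map_sum, map_smul, Finset.mul_sum,
    _root_.sum_apply, _root_.smul_apply, smul_eq_mul, Pi.star_apply, star_trivial]
  rw [Finset.sum_comm]
  refine Finset.sum_congr rfl fun b _ => Finset.sum_congr rfl fun a _ => ?_
  ring

lemma SubspaceNetwork.RealCosts.monotoneCosts {N P : ℕ} {M : Fin N → ℕ} {U : Matrix (NetIdx M) (Fin P) ℝ}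
    {J : ∀ k, Vec ℝ (M k) → ℝ} {νk δk : Fin N → ℝ} {ν δ : ℝ} (h : RealCosts U J νk δk ν δ)
    (hU : Uᴴ * U = 1) :
    MonotoneCosts U J (fun k => gradient (J k)) 1 (ν / 1) ((∑ k, |δk k|) / 1) := by
  refine monotoneCosts_of_hessian h.twice_diff one_pos h.ν_pos ?_ ?_ ?_ ?_
  · intro k x z
    rw [one_mul, gradient, InnerProductSpace.toDual_symm_apply]
    rfl
  · intro k x z
    rw [← realHessian_quadratic (h.twice_diff k)]
    refine (mul_nonneg (h.νk_nonneg k) ?_).trans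
      (le_quadratic_of_smul_one_le (h.hessian_lower k x) (WithLp.ofLp z))
    positivity
  · intro k x z
    rw [← realHessian_quadratic (h.twice_diff k), EuclideanSpace.norm_sq_eq]
    exact quadratic_le_of_le_smul_one (h.hessian_upper k x) (WithLp.ofLp z)
  · rintro x z ⟨s, hs⟩
    have h1 := le_quadratic_of_smul_one_le (h.aggregate_lower x) s
    -- Semi-unitarity gives `‖s‖ = ‖U s‖`, so the bound in the coordinates `s` becomes one in `z = U
    -- s`.
    rw [quadratic_congruence, quadratic_blockDiagonal', ← norm_mulVec_of_semiunitary hU,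
      Fintype.sum_sigma] at h1
    simp_rw [← hs] at h1
    simp_rw [EuclideanSpace.norm_sq_eq, ← realHessian_quadratic (h.twice_diff _)]
    exact h1

end Real

/-! Complex data -/

section Complex

open ComplexConjugate

variable {m : ℕ}

/-- A real-linear map is the sum of a complex-linear and a conjugate-linear one; the Wirtinger
expressions are their coefficients. -/
lemma eq_sum_wirtinger (T : Vec ℂ m →L[ℝ] ℂ) (z : Vec ℂ m) :
    T z = ∑ n, (z n * ((T (EuclideanSpace.single n 1)
        - Complex.I * T (EuclideanSpace.single n Complex.I)) / 2)
      + conj (z n) * ((T (EuclideanSpace.single n 1)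
        + Complex.I * T (EuclideanSpace.single n Complex.I)) / 2)) := by
  have hz : z = ∑ n, ((z n).re • EuclideanSpace.single n (1 : ℂ)
      + (z n).im • EuclideanSpace.single n Complex.I) := by
    ext i
    simp [Finset.sum_apply, Finset.sum_add_distrib, Pi.single_apply, Complex.re_add_im]
  conv_lhs => rw [hz]
  rw [map_sum]
  refine Finset.sum_congr rfl fun n _ => ?_
  have h1 : z n = (z n).re + (z n).im * Complex.I := (Complex.re_add_im _).symm
  have h2 : conj (z n) = (z n).re - (z n).im * Complex.I := by
    apply Complex.ext <;> simp
  rw [map_add, map_smul, map_smul, h2, Complex.real_smul, Complex.real_smul]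
  conv_rhs => rw [h1]
  simp only [Complex.add_re, Complex.ofReal_re, Complex.add_im, Complex.ofReal_im, Complex.mul_re,
    Complex.mul_im, Complex.I_re, Complex.I_im]
  push_cast
  linear_combination (((z n).im : ℂ) * T (EuclideanSpace.single n Complex.I)) * Complex.I_sq

lemma fderiv_eq_sum_wirtinger (f : Vec ℂ m → ℂ) (w z : Vec ℂ m) :
    fderiv ℝ f w z = ∑ n, (z n * dW n f w + conj (z n) * dWbar n f w) :=
  eq_sum_wirtinger _ _

variable {J : Vec ℂ m → ℝ}

lemma fderiv_ofReal (hJ : TwiceDifferentiable J) (w z : Vec ℂ m) :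
    fderiv ℝ (fun v => (J v : ℂ)) w z = (fderiv ℝ J w z : ℂ) := by
  have h := (Complex.ofRealCLM.hasFDerivAt.comp w (hJ.1 w).hasFDerivAt).fderiv
  exact DFunLike.congr_fun h z

lemma conj_dW (hJ : TwiceDifferentiable J) (n : Fin m) (w : Vec ℂ m) :
    conj (dW n (fun v => (J v : ℂ)) w) = dWbar n (fun v => (J v : ℂ)) w := by
  simp [dW, dWbar, fderiv_ofReal hJ, map_ofNat]

lemma fderiv_eq_re_dW (hJ : TwiceDifferentiable J) (w z : Vec ℂ m) :
    fderiv ℝ J w z = 2 * (∑ n, z n * dW n (fun v => (J v : ℂ)) w).re := by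
  have h1 := fderiv_eq_sum_wirtinger (fun v => (J v : ℂ)) w z
  rw [fderiv_ofReal hJ] at h1
  have h2 := congrArg Complex.re h1
  rw [Complex.ofReal_re, Complex.re_sum] at h2
  rw [h2, Complex.re_sum, Finset.mul_sum]
  refine Finset.sum_congr rfl fun n _ => ?_
  rw [← conj_dW hJ, ← map_mul, Complex.add_re, Complex.conj_re]
  ring

lemma fderiv_eq_re_inner_wirtingerGradient (hJ : TwiceDifferentiable J) (w z : Vec ℂ m) :
    fderiv ℝ J w z = 2 * RCLike.re (inner ℂ (wirtingerGradient J w) z) := by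
  rw [fderiv_eq_re_dW hJ, PiLp.inner_apply]
  congr 2
  refine Finset.sum_congr rfl fun n _ => ?_
  change _ = z n * conj (dWbar n (fun v => (J v : ℂ)) w)
  rw [← conj_dW hJ, Complex.conj_conj]

lemma differentiable_dW (hJ : TwiceDifferentiable J) (n : Fin m) :
    Differentiable ℝ (dW n fun v => (J v : ℂ)) := by
  have h : ∀ z, Differentiable ℝ fun w => ((fderiv ℝ J w z : ℝ) : ℂ) := fun z =>
    Complex.ofRealCLM.differentiable.comp
      ((ContinuousLinearMap.apply ℝ ℝ z).differentiable.comp hJ.2)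
  have hdW : (dW n fun v => (J v : ℂ)) = fun w =>
      ((fderiv ℝ J w (EuclideanSpace.single n 1) : ℝ)
        - Complex.I * (fderiv ℝ J w (EuclideanSpace.single n Complex.I) : ℝ)) / 2 :=
    funext fun w => by rw [dW, fderiv_ofReal hJ, fderiv_ofReal hJ]
  simp_rw [hdW, div_eq_mul_inv]
  exact ((h _).fun_sub ((h _).const_mul _)).mul_const _

/-- Differentiate `fderiv ℝ J v z = 2 Re ∑ z n * dW n J v` in `v` and expand each derivative of `dW
n J` by `fderiv_eq_sum_wirtinger`: conjugate directions give the mixed Hessian, the others the pure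
one. -/
lemma second_fderiv_eq_re (hJ : TwiceDifferentiable J) (w z : Vec ℂ m) :
    fderiv ℝ (fderiv ℝ J) w z z = 2 * (star (WithLp.ofLp z) ⬝ᵥ mixedHessian J w *ᵥ WithLp.ofLp z
      + WithLp.ofLp z ⬝ᵥ pureHessian J w *ᵥ WithLp.ofLp z).re := by
  have h1 : HasFDerivAt (fun v => fderiv ℝ J v z)
      ((ContinuousLinearMap.apply ℝ ℝ z).comp (fderiv ℝ (fderiv ℝ J) w)) w :=
    (ContinuousLinearMap.apply ℝ ℝ z).hasFDerivAt.comp w (hJ.2 w).hasFDerivAt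
  have h2 : HasFDerivAt (fun v => ∑ n, z n * dW n (fun v => (J v : ℂ)) v)
      (∑ n, z n • fderiv ℝ (dW n fun v => (J v : ℂ)) w) w :=
    HasFDerivAt.fun_sum fun n _ => (differentiable_dW hJ n w).hasFDerivAt.const_mul (z n)
  have h3 := (Complex.reCLM.hasFDerivAt.comp w h2).const_mul 2
  have h4 : (fun v => fderiv ℝ J v z)
      = fun v => 2 * (Complex.reCLM ∘ fun v => ∑ n, z n * dW n (fun v => (J v : ℂ)) v) v :=
    funext fun v => fderiv_eq_re_dW hJ v z
  rw [← h4] at h3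
  have h5 := DFunLike.congr_fun (h1.unique h3) z
  refine h5.trans ?_
  change 2 * ((∑ n, z n • fderiv ℝ (dW n fun v => (J v : ℂ)) w) z).re = _
  congr 2
  rw [_root_.sum_apply]
  simp only [dotProduct, Matrix.mulVec, Finset.mul_sum, Pi.star_apply, mixedHessian, pureHessian,
    Matrix.of_apply]
  rw [Finset.sum_comm, Finset.sum_comm (f := fun a b => z a * _), ← Finset.sum_add_distrib]
  refine Finset.sum_congr rfl fun n _ => ?_
  rw [_root_.smul_apply, fderiv_eq_sum_wirtinger, smul_eq_mul, Finset.mul_sum,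
    ← Finset.sum_add_distrib]
  refine Finset.sum_congr rfl fun a _ => ?_
  rw [RCLike.star_def]
  ring

/-- The extended vector `col{z, (z^*)^⊤}`. -/
def extendedVec {ι : Type} (z : ι → ℂ) : ι ⊕ ι → ℂ := Sum.elim z (star z)

lemma norm_extendedVec {ι : Type} [Fintype ι] (z : ι → ℂ) :
    ∑ i, ‖extendedVec z i‖ ^ 2 = 2 * ∑ i, ‖z i‖ ^ 2 := by
  simp [extendedVec, Fintype.sum_sum_type, two_mul]

/-- On an extended vector the two diagonal blocks contribute equally and the two off-diagonal ones
are conjugate, so the real part is twice that of one row of blocks. -/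
lemma complexHessian_quadratic (hJ : TwiceDifferentiable J) (w z : Vec ℂ m) :
    RCLike.re (star (extendedVec (WithLp.ofLp z)) ⬝ᵥ
      complexHessian J w *ᵥ extendedVec (WithLp.ofLp z)) = fderiv ℝ (fderiv ℝ J) w z z := by
  rw [second_fderiv_eq_re hJ]
  set B := mixedHessian J w
  set C := pureHessian J w
  set x : Fin m → ℂ := WithLp.ofLp z
  have hstar : star (extendedVec x) = Sum.elim (star x) x := by
    funext i
    cases i <;> simp [extendedVec]
  have h1 : star x ⬝ᵥ Cᴴ *ᵥ star x = star (x ⬝ᵥ C *ᵥ x) := by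
    rw [Matrix.dotProduct_mulVec, ← Matrix.star_mulVec, Matrix.star_dotProduct_star]
  have h2 : x ⬝ᵥ Bᵀ *ᵥ star x = star x ⬝ᵥ B *ᵥ x := by
    rw [Matrix.mulVec_transpose, Matrix.dotProduct_mulVec, dotProduct_comm]
  rw [hstar, complexHessian, extendedVec, Matrix.fromBlocks_mulVec]
  rw [sumElim_dotProduct_sumElim]
  simp only [Sum.elim_comp_inl, Sum.elim_comp_inr]
  rw [dotProduct_add, dotProduct_add, h1, h2]
  simp only [RCLike.re_to_complex, Complex.add_re, RCLike.star_def, Complex.conj_re]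
  ring

/-- Extended vectors map to extended vectors, so testing the aggregate bound on these alone gives
the real second derivative along the range of `U`. -/
lemma extendedU_mulVec {N P : ℕ} {M : Fin N → ℕ} (U : Matrix (NetIdx M) (Fin P) ℂ)
    (s : Fin P → ℂ) (k : Fin N) :
    (fun a => (extendedU U *ᵥ extendedVec s) ⟨k, a⟩)
      = extendedVec fun a => (U *ᵥ s) ⟨k, a⟩ := by
  funext a
  cases a <;>
    simp [extendedU, extendedVec, Matrix.mulVec, dotProduct, Fintype.sum_sum_type]

lemma SubspaceNetwork.ComplexCosts.monotoneCosts {N P : ℕ} {M : Fin N → ℕ} {U : Matrix (NetIdx M) (Fin P) ℂ}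
    {J : ∀ k, Vec ℂ (M k) → ℝ} {νk δk : Fin N → ℝ} {ν δ : ℝ} (h : ComplexCosts U J νk δk ν δ)
    (hU : Uᴴ * U = 1) :
    MonotoneCosts U J (fun k => wirtingerGradient (J k)) 2 (ν / 2) ((∑ k, |δk k|) / 2) := by
  refine monotoneCosts_of_hessian h.twice_diff two_pos h.ν_pos ?_ ?_ ?_ ?_
  · exact fun k x z => fderiv_eq_re_inner_wirtingerGradient (h.twice_diff k) x z
  · intro k x z
    rw [← complexHessian_quadratic (h.twice_diff k)]
    refine (mul_nonneg (div_nonneg (h.νk_nonneg k) two_pos.le) ?_).trans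
      (le_quadratic_of_smul_one_le (h.hessian_lower k x) (extendedVec (WithLp.ofLp z)))
    positivity
  · intro k x z
    rw [← complexHessian_quadratic (h.twice_diff k), EuclideanSpace.norm_sq_eq]
    refine (quadratic_le_of_le_smul_one (h.hessian_upper k x)
      (extendedVec (WithLp.ofLp z))).trans_eq ?_
    rw [norm_extendedVec]
    ring
  · rintro x z ⟨s, hs⟩
    have h1 := le_quadratic_of_smul_one_le (h.aggregate_lower x) (extendedVec s)
    rw [quadratic_congruence, quadratic_blockDiagonal', norm_extendedVec,
      ← norm_mulVec_of_semiunitary hU, Fintype.sum_sigma, map_sum] at h1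
    simp_rw [extendedU_mulVec, ← hs] at h1
    simp_rw [EuclideanSpace.norm_sq_eq, ← complexHessian_quadratic (h.twice_diff _)]
    -- The factor 2 in the norm of an extended vector cancels the `ν / 2` of the Hessian bound.
    refine le_trans (le_of_eq ?_) h1
    ring

end Complex

end

/-! ### The theorem for both scalar fields -/

theorem theorem1 {N P : ℕ} (M : Fin N → ℕ) (𝒩 : Fin N → Finset (Fin N))
    (νk δk β σ : Fin N → ℝ) (ν δ : ℝ) :
    -- real data (h = 1)
    (∀ (U : Matrix (NetIdx M) (Fin P) ℝ) (A : Matrix (NetIdx M) (NetIdx M) ℝ)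
        (J : ∀ k, Vec ℝ (M k) → ℝ),
      Uᴴ * U = 1 → IsCombinationMatrix 𝒩 U A → RealCosts U J νk δk ν δ →
      (∃! wo, IsConstrainedMin J U wo) ∧
      ∀ wo, IsConstrainedMin J U wo →
        ∃ μ₀ > (0 : ℝ), ∃ C : ℝ, ∀ μ : ℝ, 0 < μ → μ ≤ μ₀ →
          ∀ (Ω : Type u) [MeasurableSpace Ω] (Pr : Measure Ω) [IsProbabilityMeasure Pr]
            (ghat : ∀ k, ℕ → Ω → Vec ℝ (M k) → Vec ℝ (M k)) (w0 : ∀ k, Ω → Vec ℝ (M k)),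
            (∀ k i, Measurable (Function.uncurry (ghat k i))) →
            (∀ k, Measurable (w0 k)) → (∀ k, MemLp (w0 k) 2 Pr) →
            GradientNoise Pr 1 (fun k => gradient (J k)) ghat
              (iterates μ 𝒩 A ghat w0) β σ →
            ∀ k, limsup (fun i => ∫⁻ ω, ‖wo k - iterates μ 𝒩 A ghat w0 i k ω‖ₑ ^ 2 ∂Pr) atTop
              ≤ ENNReal.ofReal (C * μ)) ∧
    -- complex data (h = 2)
    (∀ (U : Matrix (NetIdx M) (Fin P) ℂ) (A : Matrix (NetIdx M) (NetIdx M) ℂ)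
        (J : ∀ k, Vec ℂ (M k) → ℝ),
      Uᴴ * U = 1 → IsCombinationMatrix 𝒩 U A → ComplexCosts U J νk δk ν δ →
      (∃! wo, IsConstrainedMin J U wo) ∧
      ∀ wo, IsConstrainedMin J U wo →
        ∃ μ₀ > (0 : ℝ), ∃ C : ℝ, ∀ μ : ℝ, 0 < μ → μ ≤ μ₀ →
          ∀ (Ω : Type u) [MeasurableSpace Ω] (Pr : Measure Ω) [IsProbabilityMeasure Pr]
            (ghat : ∀ k, ℕ → Ω → Vec ℂ (M k) → Vec ℂ (M k)) (w0 : ∀ k, Ω → Vec ℂ (M k)),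
            (∀ k i, Measurable (Function.uncurry (ghat k i))) →
            (∀ k, Measurable (w0 k)) → (∀ k, MemLp (w0 k) 2 Pr) →
            GradientNoise Pr 2 (fun k => wirtingerGradient (J k)) ghat
              (iterates μ 𝒩 A ghat w0) β σ →
            ∀ k, limsup (fun i => ∫⁻ ω, ‖wo k - iterates μ 𝒩 A ghat w0 i k ω‖ₑ ^ 2 ∂Pr) atTop
              ≤ ENNReal.ofReal (C * μ)) := by
  refine ⟨fun U A J hU hA hJ => ?_, fun U A J hU hA hJ => ?_⟩
  · have h := hJ.monotoneCosts hU
    exact ⟨h.existsUnique_isConstrainedMin hU hA,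
      fun wo hwo => h.network_stability hU hA 1 β σ hwo⟩
  · have h := hJ.monotoneCosts hU
    exact ⟨h.existsUnique_isConstrainedMin hU hA,
      fun wo hwo => h.network_stability hU hA 2 β σ hwo⟩
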